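/- Let $(X_t)$ be a strictly stationary sequence of real random variables whose marginals are regularly varying with index $\alpha\in(0,2)$ and normalizing sequence $(a_n)$, i.e. $nP(|X_0|>a_nx)\to x^{-\alpha}$ for every $x>0$, and satisfy the tail balancing condition that $\lim_{x\to\infty}P(X_0>x)/P(|X_0|>x)$ exists. Let $p=p_n$ be integers with $p_n\to\infty$ as $n\to\infty$, and for each $n$ let $\mathbf X=(X_{it})_{1\le i\le p,\,1\le t\le n}$ be a random $p\times n$ matrix whose rows are independent copies of $(X_1,\dots,X_n)$. Let $\lambda_1,\dots,\lambda_p$ be the eigenvalues of $\mathbf X\mathbf X^{\mathsf T}$ and $\lambda_{(1)}\ge\dots\ge\lambda_{(p)}$ the same eigenvalues in decreasing order. Assume that for some $b\ge 0$ $$p\,P\Big(\sum_{t=1}^n X_t^2>a_{np}^2x\Big)\longrightarrow b\,x^{-\alpha/2}\quad\text{for each }x>0,$$ and that $p_n=O(n^\beta)$ for some $\beta>0$, where $\beta<\frac{2-\alpha}{\alpha-1}$ if $1<\alpha<2$. Let $\Gamma_i=E_1+\dots+E_i$, where $E_1,E_2,\dots$ are iid exponential random variables with mean one. Then, as $n\to\infty$,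 the point processes on $(0,\infty)$ satisfy $$\sum_{i=1}^p\varepsilon_{a_{np}^{-2}\lambda_i}\ \xrightarrow{D}\ \sum_{i=1}^\infty\varepsilon_{b^{2/\alpha}\Gamma_i^{-2/\alpha}}$$ (here $\varepsilon_x$ is the unit point mass at $x$, and points at $0$ are not counted), that is, $$E\,e^{-\sum_{i=1}^pf(a_{np}^{-2}\lambda_i)}\longrightarrow E\,e^{-\sum_{i=1}^\infty f(b^{2/\alpha}\Gamma_i^{-2/\alpha})}$$ for every continuous $f:(0,\infty)\to[0,\infty)$ with compact support, extended by $f(0)=0$. Consequently, for every fixed $k$, $$a_{np}^{-2}(\lambda_{(1)},\dots,\lambda_{(k)})\ \xrightarrow{D}\ b^{2/\alpha}\big(\Gamma_1^{-2/\alpha},\dots,\Gamma_k^{-2/\alpha}\big).$$ -/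

import Mathlib

open MeasureTheory ProbabilityTheory Filter Topology

namespace HeavyTail

/-- A sequence of real random variables is strictly stationary if its law on `ℕ → ℝ` is invariant
under all time shifts. -/
def IsStrictlyStationary {Ω : Type*} [MeasurableSpace Ω] (X : ℕ → Ω → ℝ) (μ : Measure Ω) : Prop :=
  ∀ h : ℕ, IdentDistrib (fun ω (t : ℕ) => X (t + h) ω) (fun ω (t : ℕ) => X t ω) μ μ

/-- `Z` has regularly varying tails with index `α` and normalizing sequence `a`:
`n P(|Z| > a_n x) → x^{-α}` for every `x > 0`. -/
def IsRegVaryingWith {Ω : Type*} [MeasurableSpace Ω] (Z : Ω → ℝ) (μ : Measure Ω)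
    (α : ℝ) (a : ℕ → ℝ) : Prop :=
  ∀ x : ℝ, 0 < x →
    Tendsto (fun n : ℕ => (n : ℝ) * μ.real {ω | a n * x < |Z ω|}) atTop (𝓝 (x ^ (-α)))

/-- Tail balancing: `P(Z > x) / P(|Z| > x)` has a limit as `x → ∞`. -/
def IsTailBalanced {Ω : Type*} [MeasurableSpace Ω] (Z : Ω → ℝ) (μ : Measure Ω) : Prop :=
  ∃ q : ℝ, Tendsto (fun x : ℝ => μ.real {ω | x < Z ω} / μ.real {ω | x < |Z ω|}) atTop (𝓝 q)

/-- The matrix `A Aᵀ` is Hermitian (real symmetric). -/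
theorem isHermitian_gram {p n : ℕ} (A : Matrix (Fin p) (Fin n) ℝ) :
    (A * A.transpose).IsHermitian := by
  simpa using Matrix.isHermitian_mul_conjTranspose_self A

/-- The eigenvalues `λ_1, …, λ_p` of `A Aᵀ`, with multiplicity. -/
noncomputable def gramEigenvalues {p n : ℕ} (A : Matrix (Fin p) (Fin n) ℝ) : Fin p → ℝ :=
  (isHermitian_gram A).eigenvalues

/-- The eigenvalues `λ_(1) ≥ λ_(2) ≥ …` of `A Aᵀ` in decreasing order and with multiplicity, counted
from the index `0`; the sequence is continued by `0` after its first `p` entries. -/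
noncomputable def gramEigenvaluesSorted {p n : ℕ} (A : Matrix (Fin p) (Fin n) ℝ) (j : ℕ) : ℝ :=
  if h : j < Fintype.card (Fin p) then (isHermitian_gram A).eigenvalues₀ ⟨j, h⟩ else 0

/-- The point measure `∑_i ε_{x_i}` on the state space `(0, ∞)`; it is represented as a measure on
`ℝ` carried by `(0, ∞)`, so points outside `(0, ∞)` are not counted. -/
noncomputable def pointMeasure {ι : Type*} (x : ι → ℝ) : Measure ℝ :=
  (Measure.sum fun i => Measure.dirac (x i)).restrict (Set.Ioi 0)

/-- `ξ` is a random locally finite measure on `(0, ∞)`: it is measurable and almost surely gives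
finite mass to every compact subset of `(0, ∞)`. -/
structure IsLocallyFiniteProcess {Ω : Type*} [MeasurableSpace Ω] (ξ : Ω → Measure ℝ)
    (μ : Measure Ω) : Prop where
  aemeasurable : AEMeasurable ξ μ
  locally_finite : ∀ᵐ ω ∂μ, ∀ K : Set ℝ, IsCompact K → K ⊆ Set.Ioi 0 → ξ ω K < ⊤

/-- Convergence in distribution of point processes on `(0, ∞)`: convergence of the Laplace
functionals `E exp (-∫ f dξ_n) → E exp (-∫ f dη)` for all continuous `f ≥ 0` whose support is a
compact subset of `(0, ∞)`. -/
structure TendstoPointProcess {Ω : ℕ → Type*} [∀ n, MeasurableSpace (Ω n)]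
    {Ω' : Type*} [MeasurableSpace Ω']
    (ξ : (n : ℕ) → Ω n → Measure ℝ) (η : Ω' → Measure ℝ)
    (μ : (n : ℕ) → Measure (Ω n)) (ν : Measure Ω') : Prop where
  process : ∀ n, IsLocallyFiniteProcess (ξ n) (μ n)
  process_limit : IsLocallyFiniteProcess η ν
  laplace : ∀ f : ℝ → ℝ, Continuous f → (∀ x, 0 ≤ f x) → HasCompactSupport f →
    tsupport f ⊆ Set.Ioi 0 →
    Tendsto (fun n => ∫ ω, Real.exp (-∫ x, f x ∂(ξ n ω)) ∂(μ n)) atTop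
      (𝓝 (∫ ω, Real.exp (-∫ x, f x ∂(η ω)) ∂ν))

/-- The successive sums `Γ_1 = E_1, Γ_2 = E_1 + E_2, …`, with both sequences indexed from `0`, i.e.
`arrival E i = E 0 + ⋯ + E i`. -/
def arrival {Ω : Type*} (E : ℕ → Ω → ℝ) (i : ℕ) (ω : Ω) : ℝ :=
  ∑ k ∈ Finset.range (i + 1), E k ω

/-- The points `b^{2/α} Γ_i^{-2/α}` of the limiting process. -/
noncomputable def limitPoint {Ω : Type*} (α b : ℝ) (E : ℕ → Ω → ℝ) (i : ℕ) (ω : Ω) : ℝ :=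
  b ^ (2 / α) * (arrival E i ω) ^ (-(2 / α))

end HeavyTail

/-! At the scale a_{np}^2 the matrix X Xᵀ is asymptotically its own diagonal, whose entries are iid
row sums of squares; for these the large deviation hypothesis is exactly what makes the extremes
Poissonian.

Off the diagonal: Weyl's inequality in counting form (`excCount_le_of_quadratic_form_le`) and
Schur's test bound the distance between ordered eigenvalues and ordered diagonal entries by absolute
off-diagonal row sums (`abs_gramEigenvaluesSorted_sub_le`). Entries of distinct rows are
independent, so X_it X_kt has a finite r-th absolute moment for every r < α. With N = np, Markov's
inequality and a union bound over the p rows give a probability of order p N^{max(r,1)} a_N^{-2r}.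
Potter bounds give a_N ≥ const · N^{1/s} for s > α, and p = O(n^β) gives p = O(N^{β/(1+β)}). For r,
s close to α this vanishes as soon as β/(1+β) < 2 − max(α,1), which is the growth condition
(`exists_moment_exponents`, `tendsto_measure_offDiagBound`).

On the diagonal: p ordered uniform variables have the law of (Γ_1, …, Γ_p)/Γ_{p+1}
(`lintegral_uniform_eq_arrivals`). Composition with the tail quantile of the row law realises the
ordered diagonal on the space of the exponentials. There p Γ_j/Γ_{p+1} → Γ_j almost surely, and the
quantile at u_n with p u_n → v tends to b^{2/α} v^{-2/α} (`tendsto_tailQuantile`).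

Slutsky's theorem transfers the limit to the largest eigenvalues. The point process statement
follows from it: f vanishes near 0 and the limit points tend to 0, so up to a small error the
Laplace functional sees only finitely many of the largest points
(`tendsto_laplace_of_tendstoInDistribution`). -/

namespace HeavyTail

/-! ### Order statistics through counting functions. -/

section OrderStatistics

variable {ι κ : Type*} [Fintype ι] [Fintype κ]

/-- The number of entries of `d` that exceed `x`. -/
noncomputable def excCount (d : ι → ℝ) (x : ℝ) : ℕ :=
  (Finset.univ.filter fun i => x < d i).card

/-- The `j`-th largest entry, counted from `j = 0`, of the positive part of `d`;
it is `0` from the index `j = card ι` on. -/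
noncomputable def orderStat (d : ι → ℝ) (j : ℕ) : ℝ :=
  sInf {x : ℝ | 0 ≤ x ∧ excCount d x ≤ j}

lemma excCount_anti (d : ι → ℝ) : Antitone (excCount d) := fun x y h => by
  apply Finset.card_le_card
  intro i hi
  simp only [Finset.mem_filter, Finset.mem_univ, true_and] at hi ⊢
  linarith

/-- Finitely many entries exceed `x`, so a small move to the right loses none of them. This
right-continuity makes the infimum in `orderStat` attained. -/
lemma exists_excCount_eq (d : ι → ℝ) (x : ℝ) : ∃ y, x < y ∧ excCount d y = excCount d x := by
  have h : ∀ᶠ y in 𝓝[>] x, ∀ i, x < d i → y < d i := by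
    rw [eventually_all]
    intro i
    by_cases hi : x < d i
    · filter_upwards [nhdsWithin_le_nhds (eventually_lt_nhds hi)] with y hy _ using hy
    · exact Eventually.of_forall fun y h => absurd h hi
  obtain ⟨y, hy, hxy⟩ := (h.and self_mem_nhdsWithin).exists
  refine ⟨y, hxy, le_antisymm (excCount_anti d (le_of_lt hxy)) (Finset.card_le_card ?_)⟩
  intro i hi
  simp only [Finset.mem_filter, Finset.mem_univ, true_and] at hi ⊢
  exact hy i hi

lemma orderStat_set_nonempty (d : ι → ℝ) (j : ℕ) :
    {x : ℝ | 0 ≤ x ∧ excCount d x ≤ j}.Nonempty := by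
  refine ⟨∑ i, |d i|, Finset.sum_nonneg fun i _ => abs_nonneg _, ?_⟩
  have : excCount d (∑ i, |d i|) = 0 := by
    rw [excCount, Finset.card_eq_zero, Finset.filter_eq_empty_iff]
    intro i _
    rw [not_lt]
    exact (le_abs_self _).trans
      (Finset.single_le_sum (f := fun i => |d i|) (fun i _ => abs_nonneg _) (Finset.mem_univ i))
  omega

lemma orderStat_nonneg (d : ι → ℝ) (j : ℕ) : 0 ≤ orderStat d j :=
  Real.sInf_nonneg fun _ hx => hx.1

/-- Reduces comparisons of order statistics to comparisons of counts, the form in which Weyl's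
inequality and permutation invariance are proved. -/
lemma orderStat_le_iff (d : ι → ℝ) (j : ℕ) {x : ℝ} (hx : 0 ≤ x) :
    orderStat d j ≤ x ↔ excCount d x ≤ j := by
  have hbdd : BddBelow {x : ℝ | 0 ≤ x ∧ excCount d x ≤ j} := ⟨0, fun y hy => hy.1⟩
  constructor
  · intro h
    obtain ⟨y, hxy, hy⟩ := exists_excCount_eq d x
    obtain ⟨z, hz, hzy⟩ := exists_lt_of_csInf_lt (orderStat_set_nonempty d j)
      (lt_of_le_of_lt h hxy)
    rw [← hy]
    exact (excCount_anti d hzy.le).trans hz.2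
  · intro h
    exact csInf_le hbdd ⟨hx, h⟩

lemma excCount_comp_equiv (d : κ → ℝ) (e : ι ≃ κ) (x : ℝ) :
    excCount (fun i => d (e i)) x = excCount d x := by
  unfold excCount
  exact Finset.card_bij (fun i _ => e i) (by simp) (by simp)
    (fun b hb => ⟨e.symm b, by simpa using hb, by simp⟩)

lemma orderStat_comp_equiv (d : κ → ℝ) (e : ι ≃ κ) (j : ℕ) :
    orderStat (fun i => d (e i)) j = orderStat d j := by
  simp only [orderStat, excCount_comp_equiv]

lemma orderStat_le_add {d : ι → ℝ} {d' : κ → ℝ} {ε : ℝ} (hε : 0 ≤ ε)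
    (h : ∀ x, 0 ≤ x → excCount d (x + ε) ≤ excCount d' x) (j : ℕ) :
    orderStat d j ≤ orderStat d' j + ε := by
  have h0 := orderStat_nonneg d' j
  rw [orderStat_le_iff _ _ (by linarith)]
  exact (h _ h0).trans ((orderStat_le_iff _ _ h0).1 le_rfl)

lemma orderStat_eq_of_antitone {p : ℕ} {s : Fin p → ℝ} (hs : Antitone s) (h0 : ∀ i, 0 ≤ s i)
    (j : ℕ) : orderStat s j = if h : j < p then s ⟨j, h⟩ else 0 := by
  -- Both sides of the claim are nonnegative, so having the same upper bounds in `[0, ∞)` makes them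
  -- equal.
  have key : ∀ x, 0 ≤ x → (excCount s x ≤ j ↔ (if h : j < p then s ⟨j, h⟩ else 0) ≤ x) := by
    intro x hx
    split_ifs with h
    · constructor
      · intro hc
        by_contra! hlt
        have : (Finset.univ.filter fun i : Fin p => i ≤ ⟨j, h⟩).card ≤ excCount s x := by
          apply Finset.card_le_card
          intro i hi
          simp only [Finset.mem_filter, Finset.mem_univ, true_and] at hi ⊢
          exact lt_of_lt_of_le hlt (hs hi)
        have h2 : (Finset.univ.filter fun i : Fin p => i ≤ ⟨j, h⟩) = Finset.Iic ⟨j, h⟩ := by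
          ext; simp
        rw [h2, Fin.card_Iic] at this
        simp at this
        omega
      · intro hle
        have : excCount s x ≤ (Finset.Iio (⟨j, h⟩ : Fin p)).card := by
          apply Finset.card_le_card
          intro i hi
          simp only [Finset.mem_filter, Finset.mem_univ, true_and, Finset.mem_Iio] at hi ⊢
          by_contra! hji
          exact absurd (hs hji) (by linarith)
        simpa using this
    · simp only [hx, iff_true]
      have : excCount s x ≤ p := (Finset.card_filter_le _ _).trans (by simp)
      omega
  have hnn : 0 ≤ (if h : j < p then s ⟨j, h⟩ else 0) := by
    split_ifs
    exacts [h0 _, le_rfl]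
  apply le_antisymm
  · rw [orderStat_le_iff _ _ hnn, key _ hnn]
  · rw [← key _ (orderStat_nonneg s j), ← orderStat_le_iff _ _ (orderStat_nonneg s j)]

lemma measurable_orderStat (j : ℕ) : Measurable fun d : ι → ℝ => orderStat d j := by
  refine measurable_of_Iic fun x => ?_
  by_cases hx : 0 ≤ x
  · have : (fun d : ι → ℝ => orderStat d j) ⁻¹' Set.Iic x
        = {d : ι → ℝ | ∑ i, (Set.Ioi x).indicator (fun _ => (1 : ℝ)) (d i) ≤ j} := by
      ext d
      simp only [Set.mem_preimage, Set.mem_Iic, Set.mem_ofPred_eq]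
      rw [orderStat_le_iff _ _ hx, excCount, Finset.card_filter, ← Nat.cast_le (α := ℝ)]
      push_cast
      simp [Set.indicator_apply]
    rw [this]
    refine measurableSet_le ?_ measurable_const
    refine Finset.measurable_sum _ fun i _ => ?_
    exact (measurable_const.indicator measurableSet_Ioi).comp (measurable_pi_apply i)
  · have : (fun d : ι → ℝ => orderStat d j) ⁻¹' Set.Iic x = ∅ := by
      ext d
      simp only [Set.mem_preimage, Set.mem_Iic, Set.mem_empty_iff_false, iff_false, not_le]
      linarith [orderStat_nonneg d j]
    rw [this]
    exact MeasurableSet.empty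

lemma orderStat_comp_of_antitoneOn {p : ℕ} {g : ℝ → ℝ} (hg : AntitoneOn g (Set.Ioi 0))
    (hg0 : ∀ u, 0 ≤ g u) {γ : Fin p → ℝ} (hγ : Monotone γ) (hγ0 : ∀ i, 0 < γ i) (j : Fin p) :
    orderStat (fun i => g (γ i)) j = g (γ j) := by
  rw [orderStat_eq_of_antitone (fun i k h => hg (hγ0 i) (hγ0 k) (hγ h)) (fun i => hg0 _)]
  simp

end OrderStatistics

/-! ### Weyl's inequality by dimension counting. -/

section Weyl

variable {ι κ E : Type*} [Fintype ι] [Fintype κ] [NormedAddCommGroup E] [InnerProductSpace ℝ E]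

/-- **Weyl's inequality** in terms of counting functions. -/
lemma excCount_le_of_quadratic_form_le [FiniteDimensional ℝ E] (u : OrthonormalBasis ι ℝ E)
    (v : OrthonormalBasis κ ℝ E) (l : ι → ℝ) (d : κ → ℝ) (ε : ℝ)
    (h : ∀ w : E, ∑ i, l i * inner ℝ (u i) w ^ 2 ≤ ∑ i, d i * inner ℝ (v i) w ^ 2 + ε * ‖w‖ ^ 2)
    (x : ℝ) : excCount l (x + ε) ≤ excCount d x := by
  by_contra! hlt
  -- The kernel of `T` consists of the vectors orthogonal to each `u i` with `l i ≤ x + ε` and to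
  -- each `v i` with `d i > x`. If the claim failed there would be fewer such conditions than
  -- dimensions; a nonzero kernel vector would have `l`-form above `(x + ε)‖w‖²` and `d`-form at
  -- most `x‖w‖²`.
  let T : E →ₗ[ℝ] ({i // ¬ x + ε < l i} ⊕ {i // x < d i} → ℝ) :=
    LinearMap.pi (Sum.elim (fun i => (innerSL ℝ (u i)).toLinearMap)
      (fun i => (innerSL ℝ (v i)).toLinearMap))
  have hdim : Module.finrank ℝ ({i // ¬ x + ε < l i} ⊕ {i // x < d i} → ℝ)
      < Module.finrank ℝ E := by
    rw [Module.finrank_fintype_fun_eq_card, Fintype.card_sum, Fintype.card_subtype_compl,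
      Fintype.card_subtype, Fintype.card_subtype, Module.finrank_eq_card_basis u.toBasis]
    have : excCount l (x + ε) ≤ Fintype.card ι := Finset.card_filter_le _ _
    unfold excCount at *
    omega
  obtain ⟨w, hw, hw0⟩ := (Submodule.ne_bot_iff _).1 (LinearMap.ker_ne_bot_of_finrank_lt (f := T) hdim)
  have hTw : ∀ k, T w k = 0 := fun k => by rw [LinearMap.mem_ker.1 hw]; rfl
  have hu : ∀ i, ¬ x + ε < l i → inner ℝ (u i) w = 0 := fun i hi => hTw (Sum.inl ⟨i, hi⟩)
  have hv : ∀ i, x < d i → inner ℝ (v i) w = 0 := fun i hi => hTw (Sum.inr ⟨i, hi⟩)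
  have hnu : ∑ i, inner ℝ (u i) w ^ 2 = ‖w‖ ^ 2 := by
    rw [← u.sum_sq_norm_inner_right w]; simp
  have hnv : ∑ i, inner ℝ (v i) w ^ 2 = ‖w‖ ^ 2 := by
    rw [← v.sum_sq_norm_inner_right w]; simp
  have h1 : ∑ i, d i * inner ℝ (v i) w ^ 2 ≤ x * ‖w‖ ^ 2 := by
    rw [← hnv, Finset.mul_sum]
    refine Finset.sum_le_sum fun i _ => ?_
    by_cases hi : x < d i
    · simp [hv i hi]
    · exact mul_le_mul_of_nonneg_right (not_lt.1 hi) (sq_nonneg _)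
  have h2 : (x + ε) * ‖w‖ ^ 2 < ∑ i, l i * inner ℝ (u i) w ^ 2 := by
    rw [← hnu, Finset.mul_sum]
    obtain ⟨i, hi⟩ : ∃ i, inner ℝ (u i) w ≠ 0 := by
      by_contra! hall
      apply hw0
      rw [← norm_eq_zero, ← sq_eq_zero_iff, ← hnu]
      simp [hall]
    refine Finset.sum_lt_sum (fun k _ => ?_) ⟨i, Finset.mem_univ _, ?_⟩
    · by_cases hk : x + ε < l k
      · exact mul_le_mul_of_nonneg_right hk.le (sq_nonneg _)
      · simp [hu k hk]
    · have : x + ε < l i := by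
        by_contra hk
        exact hi (hu i hk)
      exact mul_lt_mul_of_pos_right this (by positivity)
  have := h w
  linarith

end Weyl

/-! ### Eigenvalues of Gram matrices compared with diagonal entries. -/

section Matrices

variable {p n : ℕ}

/-- Parseval's identity for `⟨A w, w⟩` in the eigenbasis; it supplies the quadratic forms needed in
`excCount_le_of_quadratic_form_le`. -/
lemma sum_eigenvalues_mul_inner_sq {A : Matrix (Fin p) (Fin p) ℝ} (hA : A.IsHermitian)
    (w : EuclideanSpace ℝ (Fin p)) :
    ∑ i, hA.eigenvalues i * inner ℝ (hA.eigenvectorBasis i) w ^ 2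
      = ∑ i, ∑ k, A i k * (w i * w k) := by
  have hs : (Matrix.toEuclideanLin A).IsSymmetric := Matrix.isSymmetric_toEuclideanLin_iff.2 hA
  have h1 : ∀ i, inner ℝ (Matrix.toEuclideanLin A w) (hA.eigenvectorBasis i)
      = hA.eigenvalues i * inner ℝ (hA.eigenvectorBasis i) w := by
    intro i
    rw [hs, Matrix.toLpLin_apply, hA.mulVec_eigenvectorBasis, WithLp.toLp_smul,
      WithLp.toLp_ofLp, real_inner_smul_right, real_inner_comm]
  have h2 : inner ℝ (Matrix.toEuclideanLin A w) w = ∑ i, ∑ k, A i k * (w i * w k) := by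
    rw [PiLp.inner_apply]
    refine Finset.sum_congr rfl fun i _ => ?_
    rw [Matrix.toLpLin_apply]
    simp only [Matrix.mulVec, dotProduct, RCLike.inner_apply, conj_trivial]
    rw [Finset.mul_sum]
    exact Finset.sum_congr rfl fun k _ => by ring
  rw [← h2, ← hA.eigenvectorBasis.sum_inner_mul_inner]
  exact Finset.sum_congr rfl fun i _ => by rw [h1]; ring

/-- **Schur's test** for the quadratic form of a matrix with symmetric absolute values. -/
lemma quadratic_form_le_of_row_sum_le {C : Matrix (Fin p) (Fin p) ℝ} {R : ℝ}
    (hsymm : ∀ i k, |C i k| = |C k i|) (hR : ∀ i, ∑ k, |C i k| ≤ R)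
    (w : EuclideanSpace ℝ (Fin p)) :
    ∑ i, ∑ k, C i k * (w i * w k) ≤ R * ‖w‖ ^ 2 := by
  -- By the arithmetic-geometric mean inequality each cross term is shared between its row and its
  -- column; both halves then add up to absolute row sums.
  have h1 : ∀ i k, C i k * (w i * w k) ≤ |C i k| * w i ^ 2 / 2 + |C k i| * w k ^ 2 / 2 := by
    intro i k
    have h3 : C i k * (w i * w k) ≤ |C i k| * |w i * w k| := by
      rw [← abs_mul]; exact le_abs_self _
    have h4 : |w i * w k| ≤ (w i ^ 2 + w k ^ 2) / 2 := by
      rw [abs_le]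
      constructor <;> nlinarith [sq_nonneg (w i - w k), sq_nonneg (w i + w k)]
    have h5 := mul_le_mul_of_nonneg_left h4 (abs_nonneg (C i k))
    rw [← hsymm i k]
    linarith
  calc ∑ i, ∑ k, C i k * (w i * w k)
      ≤ ∑ i, ∑ k, (|C i k| * w i ^ 2 / 2 + |C k i| * w k ^ 2 / 2) :=
        Finset.sum_le_sum fun i _ => Finset.sum_le_sum fun k _ => h1 i k
    _ = ∑ i, ∑ k, |C i k| * w i ^ 2 / 2 + ∑ i, ∑ k, |C k i| * w k ^ 2 / 2 := by
        simp only [Finset.sum_add_distrib]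
    _ = ∑ i, (∑ k, |C i k|) * w i ^ 2 := by
        rw [Finset.sum_comm (f := fun i k => |C k i| * w k ^ 2 / 2), ← Finset.sum_add_distrib]
        refine Finset.sum_congr rfl fun i _ => ?_
        rw [← Finset.sum_add_distrib, Finset.sum_mul]
        exact Finset.sum_congr rfl fun k _ => by ring
    _ ≤ ∑ i, R * w i ^ 2 :=
        Finset.sum_le_sum fun i _ => mul_le_mul_of_nonneg_right (hR i) (sq_nonneg _)
    _ = R * ‖w‖ ^ 2 := by
        rw [← Finset.mul_sum, EuclideanSpace.norm_sq_eq]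
        simp

/-- Serves the continuity, and hence the measurability, of the ordered eigenvalues. -/
lemma orderStat_eigenvalues_le {A B : Matrix (Fin p) (Fin p) ℝ} (hA : A.IsHermitian)
    (hB : B.IsHermitian) {R : ℝ} (hR0 : 0 ≤ R) (hR : ∀ i, ∑ k, |A i k - B i k| ≤ R) (j : ℕ) :
    orderStat hA.eigenvalues j ≤ orderStat hB.eigenvalues j + R := by
  refine orderStat_le_add hR0 (fun x _ => excCount_le_of_quadratic_form_le hA.eigenvectorBasis
    hB.eigenvectorBasis _ _ R (fun w => ?_) x) j
  rw [sum_eigenvalues_mul_inner_sq, sum_eigenvalues_mul_inner_sq]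
  have hs : ∀ i k, |(A - B) i k| = |(A - B) k i| := fun i k => by
    have := (hA.sub hB).apply i k
    rw [← this]; simp
  have := quadratic_form_le_of_row_sum_le (C := A - B) hs hR w
  simp only [Matrix.sub_apply, sub_mul, Finset.sum_sub_distrib] at this
  linarith

lemma quadratic_form_diag (d : Fin p → ℝ) (w : EuclideanSpace ℝ (Fin p)) :
    ∑ i, d i * inner ℝ (EuclideanSpace.basisFun (Fin p) ℝ i) w ^ 2
      = ∑ i, ∑ k, Matrix.diagonal d i k * (w i * w k) := by
  refine Finset.sum_congr rfl fun i _ => ?_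
  rw [Finset.sum_eq_single i (fun k _ hk => by simp [Matrix.diagonal_apply_ne _ hk.symm])
    (by simp)]
  rw [Matrix.diagonal_apply_eq, EuclideanSpace.basisFun_apply, EuclideanSpace.inner_single_left,
    map_one, one_mul, sq]

/-- The diagonal part has the standard basis as eigenbasis and the `A i i` as eigenvalues, so Weyl's
inequality applies in both directions, with Schur's test controlling the remainder. -/
lemma abs_orderStat_eigenvalues_sub_diag_le {A : Matrix (Fin p) (Fin p) ℝ} (hA : A.IsHermitian)
    {R : ℝ} (hR0 : 0 ≤ R) (hR : ∀ i, ∑ k, (if k = i then 0 else |A i k|) ≤ R) (j : ℕ) :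
    |orderStat hA.eigenvalues j - orderStat (fun i => A i i) j| ≤ R := by
  set D := Matrix.diagonal (fun i => A i i)
  have hD : ∀ i k, |(A - D) i k| = if k = i then 0 else |A i k| := by
    intro i k
    by_cases h : k = i
    · subst h; simp [D]
    · simp [D, h, Matrix.diagonal_apply_ne _ (Ne.symm h)]
  have hs : ∀ i k, |(A - D) i k| = |(A - D) k i| := fun i k => by
    rw [hD, hD, ← hA.apply i k]
    simp [eq_comm]
  have h1 := fun w => quadratic_form_le_of_row_sum_le (C := A - D) hs
    (fun i => by simpa only [hD] using hR i) w
  have h2 := fun w => quadratic_form_le_of_row_sum_le (C := D - A) (R := R)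
    (fun i k => by
      have := hs i k
      simp only [Matrix.sub_apply] at this ⊢
      rw [abs_sub_comm, this, abs_sub_comm])
    (fun i => by
      have := hR i
      simp only [← hD, Matrix.sub_apply] at this ⊢
      simpa only [abs_sub_comm] using this) w
  rw [abs_le]
  constructor
  · have := orderStat_le_add hR0 (fun x _ => excCount_le_of_quadratic_form_le
      (EuclideanSpace.basisFun (Fin p) ℝ) hA.eigenvectorBasis (fun i => A i i) hA.eigenvalues R
      (fun w => by
        rw [sum_eigenvalues_mul_inner_sq, quadratic_form_diag]
        have := h2 w
        simp only [Matrix.sub_apply, sub_mul, Finset.sum_sub_distrib] at this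
        linarith) x) j
    linarith
  · have := orderStat_le_add hR0 (fun x _ => excCount_le_of_quadratic_form_le
      hA.eigenvectorBasis (EuclideanSpace.basisFun (Fin p) ℝ) hA.eigenvalues (fun i => A i i) R
      (fun w => by
        rw [sum_eigenvalues_mul_inner_sq, quadratic_form_diag]
        have := h1 w
        simp only [Matrix.sub_apply, sub_mul, Finset.sum_sub_distrib] at this
        linarith) x) j
    linarith

lemma gramEigenvalues_nonneg (A : Matrix (Fin p) (Fin n) ℝ) (i : Fin p) :
    0 ≤ gramEigenvalues A i := by
  have : (A * A.transpose).PosSemidef := by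
    simpa using Matrix.posSemidef_self_mul_conjTranspose A
  exact this.eigenvalues_nonneg i

/-- The reindexing `e` is the same for all matrices; this uniformity carries measurability from the
ordered to the unordered eigenvalues. -/
lemma gramEigenvalues_eq_sorted (p n : ℕ) :
    ∃ e : Fin p ≃ Fin p, ∀ (A : Matrix (Fin p) (Fin n) ℝ) (i : Fin p),
      gramEigenvalues A i = gramEigenvaluesSorted A (e i) := by
  refine ⟨(Fintype.equivOfCardEq (Fintype.card_fin _)).symm.trans
    (finCongr (Fintype.card_fin p)), fun A i => ?_⟩
  rw [gramEigenvaluesSorted, dif_pos ((Fin.is_lt _).trans_eq (Fintype.card_fin p).symm)]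
  rfl

lemma gramEigenvaluesSorted_antitone (A : Matrix (Fin p) (Fin n) ℝ) :
    Antitone fun j : Fin p => gramEigenvaluesSorted A j := by
  intro i k h
  have hi : (i : ℕ) < Fintype.card (Fin p) := by simp
  have hk : (k : ℕ) < Fintype.card (Fin p) := by simp
  simp only [gramEigenvaluesSorted, dif_pos hi, dif_pos hk]
  exact (isHermitian_gram A).eigenvalues₀_antitone h

lemma gramEigenvaluesSorted_nonneg (A : Matrix (Fin p) (Fin n) ℝ) (j : ℕ) :
    0 ≤ gramEigenvaluesSorted A j := by
  obtain ⟨e, he⟩ := gramEigenvalues_eq_sorted p n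
  by_cases h : j < p
  · have := gramEigenvalues_nonneg A (e.symm ⟨j, h⟩)
    rw [he] at this
    simpa using this
  · simp [gramEigenvaluesSorted, h]

lemma mul_gramEigenvaluesSorted (A : Matrix (Fin p) (Fin n) ℝ) {c : ℝ} (hc : 0 ≤ c) (j : ℕ) :
    c * gramEigenvaluesSorted A j = orderStat (fun i => c * gramEigenvalues A i) j := by
  obtain ⟨e, he⟩ := gramEigenvalues_eq_sorted p n
  simp only [he]
  rw [orderStat_comp_equiv (fun j : Fin p => c * gramEigenvaluesSorted A j) e,
    orderStat_eq_of_antitone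
      (fun i k h => mul_le_mul_of_nonneg_left (gramEigenvaluesSorted_antitone A h) hc)
      (fun i => mul_nonneg hc (gramEigenvaluesSorted_nonneg A i))]
  split_ifs with h
  · rfl
  · simp [gramEigenvaluesSorted, h]

lemma gramEigenvaluesSorted_eq_orderStat (A : Matrix (Fin p) (Fin n) ℝ) (j : ℕ) :
    gramEigenvaluesSorted A j = orderStat (isHermitian_gram A).eigenvalues j := by
  simpa [gramEigenvalues] using mul_gramEigenvaluesSorted A zero_le_one j

lemma orderStat_const_mul {ι : Type*} [Fintype ι] (d : ι → ℝ) {c : ℝ} (hc : 0 < c) (j : ℕ) :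
    orderStat (fun i => c * d i) j = c * orderStat d j := by
  have key : ∀ x, excCount (fun i => c * d i) x = excCount d (x / c) := fun x => by
    unfold excCount
    congr 1
    ext i
    simp only [Finset.mem_filter, Finset.mem_univ, true_and]
    rw [div_lt_iff₀' hc]
  apply le_antisymm
  · have h0 := mul_nonneg hc.le (orderStat_nonneg d j)
    rw [orderStat_le_iff _ _ h0, key, mul_div_cancel_left₀ _ hc.ne',
      ← orderStat_le_iff _ _ (orderStat_nonneg d j)]
  · have h0 := orderStat_nonneg (fun i => c * d i) j
    rw [← le_div_iff₀' hc, orderStat_le_iff _ _ (by positivity), ← key, ← orderStat_le_iff _ _ h0]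

/-- The sum of `|A i t| |A k t|` over `t` and `k ≠ i`. It bounds the absolute row sum of the
off-diagonal part of `A Aᵀ`. -/
noncomputable def offDiagBound (A : Matrix (Fin p) (Fin n) ℝ) (i : Fin p) : ℝ :=
  ∑ k, ∑ t, if k = i then 0 else |A i t| * |A k t|

lemma abs_gramEigenvaluesSorted_sub_le (A : Matrix (Fin p) (Fin n) ℝ) {R : ℝ} (hR0 : 0 ≤ R)
    (hR : ∀ i, offDiagBound A i ≤ R) (j : ℕ) :
    |gramEigenvaluesSorted A j - orderStat (fun i => ∑ t, A i t ^ 2) j| ≤ R := by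
  have h : (fun i => ∑ t, A i t ^ 2) = fun i => (A * A.transpose) i i := by
    ext i
    simp [Matrix.mul_apply, sq]
  rw [gramEigenvaluesSorted_eq_orderStat, h]
  refine abs_orderStat_eigenvalues_sub_diag_le _ hR0 (fun i => (le_trans ?_ (hR i))) j
  refine Finset.sum_le_sum fun k _ => ?_
  split_ifs with hk
  · simp
  · rw [Matrix.mul_apply]
    refine (Finset.abs_sum_le_sum_abs _ _).trans (le_of_eq ?_)
    exact Finset.sum_congr rfl fun t _ => by simp [abs_mul]

/-- By Weyl's inequality the change is at most the total entrywise change `R` of the Gram matrix, a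
continuous function of `B` that vanishes at `A`. -/
lemma continuous_gramEigenvaluesSorted (j : ℕ) :
    Continuous fun A : Fin p → Fin n → ℝ => gramEigenvaluesSorted (Matrix.of A) j := by
  rw [continuous_iff_continuousAt]
  intro A
  let R : (Fin p → Fin n → ℝ) → ℝ := fun B =>
    ∑ i, ∑ k, |∑ t, B i t * B k t - ∑ t, A i t * A k t|
  have hRc : Continuous R := by fun_prop
  have hRA : Tendsto R (𝓝 A) (𝓝 0) := by
    have := hRc.tendsto A
    simpa [R] using this
  refine tendsto_iff_norm_sub_tendsto_zero.2
    (squeeze_zero (fun _ => norm_nonneg _) (fun B => ?_) hRA)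
  have hR0 : 0 ≤ R B := Finset.sum_nonneg fun i _ => Finset.sum_nonneg fun k _ => abs_nonneg _
  have hrow : ∀ i, ∑ k, |∑ t, B i t * B k t - ∑ t, A i t * A k t| ≤ R B := fun i =>
    Finset.single_le_sum (f := fun i => ∑ k, |∑ t, B i t * B k t - ∑ t, A i t * A k t|)
      (fun i _ => Finset.sum_nonneg fun k _ => abs_nonneg _) (Finset.mem_univ i)
  beta_reduce
  rw [gramEigenvaluesSorted_eq_orderStat, gramEigenvaluesSorted_eq_orderStat, Real.norm_eq_abs,
    abs_sub_le_iff]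
  constructor
  · have := orderStat_eigenvalues_le (isHermitian_gram (Matrix.of B))
      (isHermitian_gram (Matrix.of A)) hR0
      (fun i => by simpa [Matrix.mul_apply] using hrow i) j
    linarith
  · have := orderStat_eigenvalues_le (isHermitian_gram (Matrix.of A))
      (isHermitian_gram (Matrix.of B)) hR0
      (fun i => by
        simpa [Matrix.mul_apply, abs_sub_comm] using hrow i) j
    linarith

end Matrices

/-! ### Potter bounds derived from the normalizing sequence. -/

section RegularVariation

variable {G : ℝ → ℝ} {a : ℕ → ℝ} {α : ℝ}

/-- If `a n ≤ 0`, then `2 * a n ≤ a n`, so the tail at the doubled argument would be the larger one,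
against the order `2 ^ (-α) < 1` of the limits. -/
lemma eventually_pos_of_regVarying (hG : Antitone G) (hα : 0 < α)
    (h : ∀ x : ℝ, 0 < x → Tendsto (fun n : ℕ => (n : ℝ) * G (a n * x)) atTop (𝓝 (x ^ (-α)))) :
    ∀ᶠ n in atTop, 0 < a n := by
  have h1 := h 1 one_pos
  have h2 := h 2 two_pos
  have hlt : (2 : ℝ) ^ (-α) < 1 ^ (-α) := by
    rw [Real.one_rpow]
    exact Real.rpow_lt_one_of_one_lt_of_neg one_lt_two (by linarith)
  filter_upwards [h2.eventually_lt h1 hlt] with n hn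
  by_contra! hle
  exact absurd (mul_le_mul_of_nonneg_left (hG (by linarith : a n * 2 ≤ a n * 1))
    (Nat.cast_nonneg n)) (not_le.2 hn)

lemma tendsto_atTop_of_regVarying (hG : Antitone G) (hG0 : ∀ x, 0 ≤ G x) (hα : 0 < α)
    (h : ∀ x : ℝ, 0 < x → Tendsto (fun n : ℕ => (n : ℝ) * G (a n * x)) atTop (𝓝 (x ^ (-α)))) :
    Tendsto a atTop atTop := by
  have hpos := eventually_pos_of_regVarying hG hα h
  rw [tendsto_atTop]
  by_contra! hne
  obtain ⟨C, hC⟩ := hne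
  have hC' : ∃ᶠ n in atTop, a n ≤ max C 1 := hC.mono fun n hn => hn.le.trans (le_max_left _ _)
  have hC0 : 0 < max C 1 := lt_of_lt_of_le one_pos (le_max_right _ _)
  -- Where `a n ≤ C`, monotonicity gives `n * G y ≤ n * G (a n * (y / C))`, which stays bounded; so
  -- `G` vanishes on `(0, ∞)`, contradicting the limit at `1`.
  have hzero : ∀ y, 0 < y → G y = 0 := by
    intro y hy
    by_contra hGy
    have hGy0 : 0 < G y := lt_of_le_of_ne (hG0 y) (Ne.symm hGy)
    have hx : 0 < y / max C 1 := div_pos hy hC0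
    have hlim := (h _ hx).eventually_lt_const (lt_add_one _)
    have hbig : Tendsto (fun n : ℕ => (n : ℝ) * G y) atTop atTop :=
      tendsto_natCast_atTop_atTop.atTop_mul_const hGy0
    obtain ⟨n, hn, hn1, hn2⟩ := (hC'.and_eventually (hlim.and (hbig.eventually_ge_atTop
      ((y / max C 1) ^ (-α) + 1)))).exists
    have : G y ≤ G (a n * (y / max C 1)) := by
      apply hG
      calc a n * (y / max C 1) ≤ max C 1 * (y / max C 1) :=
            mul_le_mul_of_nonneg_right hn hx.le
        _ = y := by field_simp
    have := mul_le_mul_of_nonneg_left this (Nat.cast_nonneg (α := ℝ) n)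
    linarith
  have h1 := (h 1 one_pos).eventually_const_lt (u := 0) (by simp)
  obtain ⟨n, hn, hn1⟩ := (hpos.and h1).exists
  rw [mul_one, hzero _ hn, mul_zero] at hn1
  exact lt_irrefl _ hn1

/-- `a` need not be monotone, but starting at or below `x` and tending to infinity it must cross `x`
at some step. -/
lemma exists_between_of_tendsto_atTop (ha : Tendsto a atTop atTop) (N : ℕ) {x : ℝ}
    (hx : a N ≤ x) : ∃ n, N ≤ n ∧ a n ≤ x ∧ x < a (n + 1) := by
  by_contra! hcon
  have hall : ∀ k, a (N + k) ≤ x := by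
    intro k
    induction k with
    | zero => simpa using hx
    | succ k ih => exact hcon (N + k) (Nat.le_add_right _ _) ih
  obtain ⟨M, hM⟩ := (ha.eventually_gt_atTop x).exists_forall_of_atTop
  have := hM (N + M) (by omega)
  linarith [hall M]

/-- Passing from `n` to `n + 1` costs only a factor tending to `1`. For `x` in `[a n, a (n + 1))`
the ratio `G (2 * x) / G x` lies between these two sequences, so its limit passes from the sequence
to the continuous variable. -/
lemma tendsto_div_of_regVarying
    (h : ∀ x : ℝ, 0 < x → Tendsto (fun n : ℕ => (n : ℝ) * G (a n * x)) atTop (𝓝 (x ^ (-α)))) :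
    Tendsto (fun n : ℕ => G (a n * 2) / G (a (n + 1))) atTop (𝓝 (2 ^ (-α))) ∧
      Tendsto (fun n : ℕ => G (a (n + 1) * 2) / G (a n)) atTop (𝓝 (2 ^ (-α))) := by
  have h1 := h 1 one_pos
  have h2 := h 2 two_pos
  have hr : Tendsto (fun n : ℕ => (n : ℝ) / ((n : ℝ) + 1)) atTop (𝓝 1) :=
    tendsto_natCast_div_add_atTop (1 : ℝ)
  rw [Real.one_rpow] at h1
  simp only [mul_one] at h1
  have h1' := h1.comp (tendsto_add_atTop_nat 1)
  have h2' := h2.comp (tendsto_add_atTop_nat 1)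
  constructor
  · have := (h2.div h1' one_ne_zero).div hr one_ne_zero
    rw [div_one, div_one] at this
    refine this.congr' ?_
    filter_upwards [eventually_gt_atTop 0] with n hn
    have : (n : ℝ) ≠ 0 := by positivity
    have h3 : (n : ℝ) + 1 ≠ 0 := by positivity
    simp only [Function.comp, Pi.div_apply]
    push_cast
    by_cases h0 : G (a (n + 1)) = 0
    · simp [h0]
    · field_simp
  · have := (h2'.div h1 one_ne_zero).mul hr
    rw [div_one, mul_one] at this
    refine this.congr' ?_
    filter_upwards [eventually_gt_atTop 0] with n hn
    have : (n : ℝ) ≠ 0 := by positivity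
    have h3 : (n : ℝ) + 1 ≠ 0 := by positivity
    simp only [Function.comp, Pi.div_apply]
    push_cast
    by_cases h0 : G (a n) = 0
    · simp [h0]
    · field_simp

lemma eventually_pos_tail
    (h : ∀ x : ℝ, 0 < x → Tendsto (fun n : ℕ => (n : ℝ) * G (a n * x)) atTop (𝓝 (x ^ (-α)))) :
    ∀ᶠ n in atTop, 0 < G (a n) := by
  filter_upwards [(h 1 one_pos).eventually_const_lt (u := 0) (by simp)] with n hn
  rw [mul_one] at hn
  exact pos_of_mul_pos_right hn (Nat.cast_nonneg n)

lemma exists_doubling_le (hG : Antitone G) (hG0 : ∀ x, 0 ≤ G x) (hα : 0 < α)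
    (h : ∀ x : ℝ, 0 < x → Tendsto (fun n : ℕ => (n : ℝ) * G (a n * x)) atTop (𝓝 (x ^ (-α))))
    {r : ℝ} (hr : r < α) : ∃ x₀ : ℝ, 0 < x₀ ∧ ∀ x, x₀ ≤ x → G (2 * x) ≤ 2 ^ (-r) * G x := by
  have ha := tendsto_atTop_of_regVarying hG hG0 hα h
  have hlt : (2 : ℝ) ^ (-α) < 2 ^ (-r) :=
    Real.rpow_lt_rpow_of_exponent_lt one_lt_two (by linarith)
  obtain ⟨N, hN⟩ := ((tendsto_div_of_regVarying h).1.eventually_lt_const hlt |>.and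
    ((tendsto_add_atTop_nat 1).eventually (eventually_pos_tail h))).exists_forall_of_atTop
  refine ⟨max (a N) 1, lt_of_lt_of_le one_pos (le_max_right _ _), fun x hx => ?_⟩
  obtain ⟨n, hn, hnx, hxn⟩ := exists_between_of_tendsto_atTop ha N ((le_max_left _ _).trans hx)
  obtain ⟨h1, h2⟩ := hN n hn
  rw [div_lt_iff₀ h2] at h1
  calc G (2 * x) ≤ G (a n * 2) := hG (by linarith)
    _ ≤ 2 ^ (-r) * G (a (n + 1)) := h1.le
    _ ≤ 2 ^ (-r) * G x := mul_le_mul_of_nonneg_left (hG hxn.le) (by positivity)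

lemma exists_le_doubling (hG : Antitone G) (hG0 : ∀ x, 0 ≤ G x) (hα : 0 < α)
    (h : ∀ x : ℝ, 0 < x → Tendsto (fun n : ℕ => (n : ℝ) * G (a n * x)) atTop (𝓝 (x ^ (-α))))
    {r : ℝ} (hr : α < r) :
    ∃ x₀ : ℝ, 0 < x₀ ∧ 0 < G x₀ ∧ ∀ x, x₀ ≤ x → 2 ^ (-r) * G x ≤ G (2 * x) := by
  have ha := tendsto_atTop_of_regVarying hG hG0 hα h
  have hlt : (2 : ℝ) ^ (-r) < 2 ^ (-α) :=
    Real.rpow_lt_rpow_of_exponent_lt one_lt_two (by linarith)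
  obtain ⟨N, hN⟩ := ((tendsto_div_of_regVarying h).2.eventually_const_lt hlt |>.and
    ((eventually_pos_tail h).and (ha.eventually_gt_atTop 0))).exists_forall_of_atTop
  refine ⟨a N, (hN N le_rfl).2.2, (hN N le_rfl).2.1, fun x hx => ?_⟩
  obtain ⟨n, hn, hnx, hxn⟩ := exists_between_of_tendsto_atTop ha N hx
  obtain ⟨h1, h2, _⟩ := hN n hn
  rw [lt_div_iff₀ h2] at h1
  calc 2 ^ (-r) * G x ≤ 2 ^ (-r) * G (a n) :=
        mul_le_mul_of_nonneg_left (hG hnx) (by positivity)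
    _ ≤ G (a (n + 1) * 2) := h1.le
    _ ≤ G (2 * x) := hG (by linarith)

lemma exists_two_pow_between {y : ℝ} (hy : 1 ≤ y) : ∃ k : ℕ, (2 : ℝ) ^ k ≤ y ∧ y < 2 ^ (k + 1) :=
  exists_nat_pow_near hy one_lt_two

lemma two_rpow_pow (r : ℝ) (k : ℕ) : ((2 : ℝ) ^ (-r)) ^ k = ((2 : ℝ) ^ k) ^ (-r) := by
  rw [← Real.rpow_natCast, ← Real.rpow_natCast, ← Real.rpow_mul two_pos.le,
    ← Real.rpow_mul two_pos.le, mul_comm]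

/-- **Potter bound**, upper half. -/
lemma exists_tail_le_rpow (hG : Antitone G) (hG0 : ∀ x, 0 ≤ G x) (hG1 : ∀ x, G x ≤ 1)
    (hα : 0 < α)
    (h : ∀ x : ℝ, 0 < x → Tendsto (fun n : ℕ => (n : ℝ) * G (a n * x)) atTop (𝓝 (x ^ (-α))))
    {r : ℝ} (hr0 : 0 < r) (hr : r < α) : ∃ C : ℝ, 0 < C ∧ ∀ x, 0 < x → G x ≤ C * x ^ (-r) := by
  obtain ⟨x₀, hx0, hd⟩ := exists_doubling_le hG hG0 hα h hr
  have hk : ∀ k : ℕ, G (2 ^ k * x₀) ≤ ((2 : ℝ) ^ (-r)) ^ k := by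
    intro k
    induction k with
    | zero => simpa using hG1 _
    | succ k ih =>
      have h1 : x₀ ≤ 2 ^ k * x₀ := le_mul_of_one_le_left hx0.le (one_le_pow₀ one_le_two)
      calc G (2 ^ (k + 1) * x₀) = G (2 * (2 ^ k * x₀)) := by ring_nf
        _ ≤ 2 ^ (-r) * G (2 ^ k * x₀) := hd _ h1
        _ ≤ 2 ^ (-r) * ((2 : ℝ) ^ (-r)) ^ k := mul_le_mul_of_nonneg_left ih (by positivity)
        _ = _ := by ring
  -- In the dyadic block of `x` one has `2 ^ k > x / (2 * x₀)`, whence the factor `2`. For `x < x₀`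
  -- the same constant makes the right side at least `1`.
  refine ⟨(2 * x₀) ^ r, by positivity, fun x hx => ?_⟩
  rcases le_or_gt x₀ x with hxx | hxx
  · obtain ⟨k, hk1, hk2⟩ := exists_two_pow_between ((one_le_div hx0).2 hxx)
    rw [le_div_iff₀ hx0] at hk1
    rw [div_lt_iff₀ hx0] at hk2
    calc G x ≤ G (2 ^ k * x₀) := hG hk1
      _ ≤ ((2 : ℝ) ^ k) ^ (-r) := by rw [← two_rpow_pow]; exact hk k
      _ ≤ (x / (2 * x₀)) ^ (-r) := by
          apply Real.rpow_le_rpow_of_nonpos (by positivity) _ (by linarith)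
          rw [div_le_iff₀ (by positivity)]
          calc x ≤ 2 ^ (k + 1) * x₀ := hk2.le
            _ = 2 ^ k * (2 * x₀) := by ring
      _ = _ := by
          rw [Real.div_rpow hx.le (by positivity), Real.rpow_neg (by positivity : 0 ≤ 2 * x₀),
            div_inv_eq_mul, mul_comm]
  · calc G x ≤ 1 := hG1 x
      _ ≤ (x / (2 * x₀)) ^ (-r) := by
          apply Real.one_le_rpow_of_pos_of_le_one_of_nonpos (by positivity) _ (by linarith)
          rw [div_le_one (by positivity)]
          linarith
      _ = _ := by
          rw [Real.div_rpow hx.le (by positivity), Real.rpow_neg (by positivity : 0 ≤ 2 * x₀),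
            div_inv_eq_mul, mul_comm]

/-- **Potter bound**, lower half. -/
lemma exists_rpow_le_tail (hG : Antitone G) (hG0 : ∀ x, 0 ≤ G x) (hα : 0 < α)
    (h : ∀ x : ℝ, 0 < x → Tendsto (fun n : ℕ => (n : ℝ) * G (a n * x)) atTop (𝓝 (x ^ (-α))))
    {r : ℝ} (hr : α < r) :
    ∃ c x₀ : ℝ, 0 < c ∧ 0 < x₀ ∧ ∀ x, x₀ ≤ x → c * x ^ (-r) ≤ G x := by
  obtain ⟨x₀, hx0, hGx, hd⟩ := exists_le_doubling hG hG0 hα h hr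
  have hk : ∀ k : ℕ, ((2 : ℝ) ^ (-r)) ^ k * G x₀ ≤ G (2 ^ k * x₀) := by
    intro k
    induction k with
    | zero => simp
    | succ k ih =>
      have h1 : x₀ ≤ 2 ^ k * x₀ := le_mul_of_one_le_left hx0.le (one_le_pow₀ one_le_two)
      calc ((2 : ℝ) ^ (-r)) ^ (k + 1) * G x₀ = 2 ^ (-r) * (((2 : ℝ) ^ (-r)) ^ k * G x₀) := by ring
        _ ≤ 2 ^ (-r) * G (2 ^ k * x₀) := mul_le_mul_of_nonneg_left ih (by positivity)
        _ ≤ G (2 * (2 ^ k * x₀)) := hd _ h1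
        _ = _ := by ring_nf
  refine ⟨(2 / x₀) ^ (-r) * G x₀, x₀, by positivity, hx0, fun x hxx => ?_⟩
  have hx : 0 < x := hx0.trans_le hxx
  obtain ⟨k, hk1, hk2⟩ := exists_two_pow_between ((one_le_div hx0).2 hxx)
  rw [le_div_iff₀ hx0] at hk1
  rw [div_lt_iff₀ hx0] at hk2
  calc (2 / x₀) ^ (-r) * G x₀ * x ^ (-r) = ((2 / x₀) * x) ^ (-r) * G x₀ := by
        rw [Real.mul_rpow (by positivity) hx.le]; ring
    _ ≤ ((2 : ℝ) ^ (k + 1)) ^ (-r) * G x₀ := by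
        refine mul_le_mul_of_nonneg_right ?_ hGx.le
        apply Real.rpow_le_rpow_of_nonpos (by positivity) _ (by linarith)
        rw [pow_succ, div_mul_eq_mul_div, le_div_iff₀ hx0]
        nlinarith
    _ ≤ G (2 ^ (k + 1) * x₀) := by rw [← two_rpow_pow]; exact hk _
    _ ≤ G x := hG hk2.le

/-- Since `m * G (a m) → 1`, it is eventually below `2`; the lower Potter bound at `x = a m` then
forces `a m` to be at least of order `m ^ (1 / r)`. -/
lemma exists_mul_le_rpow_normalizing (hG : Antitone G) (hG0 : ∀ x, 0 ≤ G x) (hα : 0 < α)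
    (h : ∀ x : ℝ, 0 < x → Tendsto (fun n : ℕ => (n : ℝ) * G (a n * x)) atTop (𝓝 (x ^ (-α))))
    {r : ℝ} (hr : α < r) : ∃ c : ℝ, 0 < c ∧ ∀ᶠ m : ℕ in atTop, 0 < a m ∧ c * m ≤ a m ^ r := by
  obtain ⟨c, x₀, hc, hx0, hle⟩ := exists_rpow_le_tail hG hG0 hα h hr
  have ha := tendsto_atTop_of_regVarying hG hG0 hα h
  refine ⟨c / 2, by positivity, ?_⟩
  filter_upwards [ha.eventually_ge_atTop x₀,
    (h 1 one_pos).eventually_lt_const (u := 2) (by simp)] with m hm h2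
  have hm0 := hx0.trans_le hm
  refine ⟨hm0, ?_⟩
  have h3 := mul_le_mul_of_nonneg_left (hle _ hm) (Nat.cast_nonneg (α := ℝ) m)
  rw [mul_one] at h2
  have h4 : (m : ℝ) * (c * a m ^ (-r)) ≤ 2 := h3.trans h2.le
  rw [Real.rpow_neg hm0.le] at h4
  have hp : 0 < a m ^ r := by positivity
  rw [← mul_assoc, ← div_eq_mul_inv, div_le_iff₀ hp] at h4
  linarith

end RegularVariation

/-! ### Finiteness of moments below the tail index. -/

section Moments

variable {Ω : Type*} [MeasurableSpace Ω] {μ : Measure Ω} [IsProbabilityMeasure μ]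

lemma antitone_tail (Z : Ω → ℝ) : Antitone fun x => μ.real {ω | x < Z ω} := fun x y h =>
  measureReal_mono fun ω (hω : y < Z ω) => lt_of_le_of_lt h hω

/-- Layer-cake formula: near `0` the integrand is at most `t ^ (r - 1)`, and near infinity a Potter
exponent `s` strictly between `r` and `α` bounds it by a multiple of `t ^ (r - 1 - s)`. -/
lemma lintegral_rpow_lt_top_of_regVarying {Z : Ω → ℝ} (hZ : AEMeasurable Z μ) {α : ℝ} (hα : 0 < α)
    {a : ℕ → ℝ} (h : IsRegVaryingWith Z μ α a) {r : ℝ} (hr0 : 0 < r) (hr : r < α) :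
    ∫⁻ ω, ENNReal.ofReal (|Z ω| ^ r) ∂μ < ⊤ := by
  obtain ⟨s, hrs, hsα⟩ := exists_between hr
  obtain ⟨C, hC, hle⟩ := exists_tail_le_rpow (antitone_tail (μ := μ) fun ω => |Z ω|)
    (fun _ => measureReal_nonneg) (fun _ => measureReal_le_one) hα h (hr0.trans hrs) hsα
  rw [lintegral_rpow_eq_lintegral_meas_lt_mul μ (Eventually.of_forall fun _ => abs_nonneg _)
    hZ.abs hr0]
  refine ENNReal.mul_lt_top ENNReal.ofReal_lt_top ?_
  rw [← Set.Ioc_union_Ioi_eq_Ioi zero_le_one]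
  refine (lintegral_union_le _ _ _).trans_lt (ENNReal.add_lt_top.2 ⟨?_, ?_⟩)
  · have hint : IntegrableOn (fun t : ℝ => t ^ (r - 1)) (Set.Ioc 0 1) :=
      (intervalIntegrable_iff_integrableOn_Ioc_of_le zero_le_one).1
        (intervalIntegral.intervalIntegrable_rpow' (by linarith))
    refine lt_of_le_of_lt ?_ hint.lintegral_lt_top
    refine lintegral_mono fun t => ?_
    exact mul_le_of_le_one_left zero_le prob_le_one
  · have hint : IntegrableOn (fun t : ℝ => C * t ^ (-s + (r - 1))) (Set.Ioi 1) :=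
      (integrableOn_Ioi_rpow_of_lt (by linarith) one_pos).const_mul C
    refine lt_of_le_of_lt ?_ hint.lintegral_lt_top
    refine setLIntegral_mono' measurableSet_Ioi fun t (ht : 1 < t) => ?_
    have ht0 : 0 < t := by linarith
    rw [Real.rpow_add ht0, ← mul_assoc, ENNReal.ofReal_mul (by positivity),
      ← ofReal_measureReal (μ := μ)]
    exact mul_le_mul_left (ENNReal.ofReal_le_ofReal (hle t ht0)) _

end Moments

/-! ### Negligibility of the off-diagonal row sums. -/

section OffDiagonal

/-- The exponent `max r 1 - 1` unites the power mean inequality for `r ≥ 1` with the subadditivity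
of `x ^ r` for `r ≤ 1`. -/
lemma ennreal_rpow_sum_le {ι : Type*} (s : Finset ι) (f : ι → ENNReal) {r : ℝ} (hr : 0 < r) :
    (∑ i ∈ s, f i) ^ r ≤ (s.card : ENNReal) ^ (max r 1 - 1) * ∑ i ∈ s, f i ^ r := by
  rcases le_total 1 r with h | h
  · rw [max_eq_left h]
    exact ENNReal.rpow_sum_le_const_mul_sum_rpow s f h
  · rw [max_eq_right h, sub_self, ENNReal.rpow_zero, one_mul]
    classical
    induction s using Finset.induction_on with
    | empty => simp [hr]
    | insert i s hi ih =>
      rw [Finset.sum_insert hi, Finset.sum_insert hi]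
      exact (ENNReal.rpow_add_le_add_rpow _ _ hr.le h).trans (add_le_add_right ih _)

variable {Ω : Type*} [MeasurableSpace Ω] {P : Measure Ω} {p n : ℕ}
  {M : Ω → Matrix (Fin p) (Fin n) ℝ}

lemma aemeasurable_entry (hM : ∀ i, AEMeasurable (fun ω (t : Fin n) => M ω i t) P) (i : Fin p)
    (t : Fin n) : AEMeasurable (fun ω => M ω i t) P :=
  (measurable_pi_apply t).comp_aemeasurable (hM i)

/-- The sum is bounded term by term, so dependence within a row is harmless. In each product the
factors come from different rows; by independence its `r`-th moment is `K ^ 2`. -/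
lemma lintegral_offDiagBound_rpow_le (hM : ∀ i, AEMeasurable (fun ω (t : Fin n) => M ω i t) P)
    (hindep : iIndepFun (fun (i : Fin p) ω (t : Fin n) => M ω i t) P) {r : ℝ} (hr : 0 < r)
    {K : ENNReal} (hK : ∀ i t, ∫⁻ ω, ENNReal.ofReal (|M ω i t| ^ r) ∂P = K) (i : Fin p) :
    ∫⁻ ω, ENNReal.ofReal (offDiagBound (M ω) i) ^ r ∂P
      ≤ ((n * p : ℕ) : ENNReal) ^ (max r 1 - 1) * (((n * p : ℕ) : ENNReal) * K ^ 2) := by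
  set F : Fin p × Fin n → Ω → ENNReal := fun x ω =>
    if x.1 = i then 0 else ENNReal.ofReal (|M ω i x.2| ^ r) * ENNReal.ofReal (|M ω x.1 x.2| ^ r)
  have hmeas : ∀ k t, AEMeasurable (fun ω => ENNReal.ofReal (|M ω k t| ^ r)) P := fun k t =>
    ((aemeasurable_entry hM k t).abs.pow_const r).ennreal_ofReal
  have hFm : ∀ x, AEMeasurable (F x) P := by
    intro x
    by_cases h : x.1 = i
    · simp only [F, h, if_true]; exact aemeasurable_const
    · simp only [F, h, if_false]; exact (hmeas _ _).mul (hmeas _ _)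
  have hle : ∀ ω, ENNReal.ofReal (offDiagBound (M ω) i) ^ r
      ≤ ((n * p : ℕ) : ENNReal) ^ (max r 1 - 1) * ∑ x, F x ω := by
    intro ω
    have h0 : ∀ x : Fin p × Fin n, 0 ≤ (if x.1 = i then 0 else |M ω i x.2| * |M ω x.1 x.2|) :=
      fun x => by split_ifs <;> positivity
    have h1 : offDiagBound (M ω) i
        = ∑ x : Fin p × Fin n, if x.1 = i then 0 else |M ω i x.2| * |M ω x.1 x.2| := by
      rw [Fintype.sum_prod_type]; rfl
    rw [h1, ENNReal.ofReal_sum_of_nonneg fun x _ => h0 x]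
    refine (ennreal_rpow_sum_le _ _ hr).trans (le_of_eq ?_)
    congr 2
    · simp [mul_comm]
    · ext x
      by_cases h : x.1 = i
      · simp [F, h, hr]
      · simp only [F, h, if_false]
        rw [ENNReal.ofReal_rpow_of_nonneg (by positivity) hr.le,
          Real.mul_rpow (abs_nonneg _) (abs_nonneg _), ENNReal.ofReal_mul (by positivity)]
  have hF : ∀ x, ∫⁻ ω, F x ω ∂P ≤ K ^ 2 := by
    intro x
    by_cases h : x.1 = i
    · simp [F, h]
    · simp only [F, h, if_false]
      have hφ : Measurable fun v : Fin n → ℝ => ENNReal.ofReal (|v x.2| ^ r) := by fun_prop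
      have hind : IndepFun (fun ω => ENNReal.ofReal (|M ω i x.2| ^ r))
          (fun ω => ENNReal.ofReal (|M ω x.1 x.2| ^ r)) P :=
        (hindep.indepFun (Ne.symm h)).comp hφ hφ
      refine le_of_eq ((lintegral_mul_eq_lintegral_mul_lintegral_of_indepFun'' (hmeas i x.2)
        (hmeas x.1 x.2) hind).trans ?_)
      rw [hK, hK, sq]
  calc ∫⁻ ω, ENNReal.ofReal (offDiagBound (M ω) i) ^ r ∂P
      ≤ ∫⁻ ω, ((n * p : ℕ) : ENNReal) ^ (max r 1 - 1) * ∑ x, F x ω ∂P := lintegral_mono hle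
    _ = ((n * p : ℕ) : ENNReal) ^ (max r 1 - 1) * ∑ x, ∫⁻ ω, F x ω ∂P := by
        rw [lintegral_const_mul'' _ (Finset.aemeasurable_fun_sum _ fun x _ => hFm x),
          lintegral_finsetSum' _ fun x _ => hFm x]
    _ ≤ ((n * p : ℕ) : ENNReal) ^ (max r 1 - 1) * ∑ _x : Fin p × Fin n, K ^ 2 := by
        gcongr with x; exact hF x
    _ = _ := by
        rw [Finset.sum_const, nsmul_eq_mul, Finset.card_univ, Fintype.card_prod]
        simp only [Fintype.card_fin]
        rw [mul_comm p n]

/-- Markov's inequality for the `r`-th moment, followed by a union bound over the `p` rows. -/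
lemma measure_exists_offDiagBound_gt_le
    (hM : ∀ i, AEMeasurable (fun ω (t : Fin n) => M ω i t) P)
    (hindep : iIndepFun (fun (i : Fin p) ω (t : Fin n) => M ω i t) P) {r : ℝ} (hr : 0 < r)
    {κ : ℝ} (hκ : 0 ≤ κ)
    (hK : ∀ i t, ∫⁻ ω, ENNReal.ofReal (|M ω i t| ^ r) ∂P = ENNReal.ofReal κ) {ε : ℝ} (hε : 0 < ε)
    (hN : 0 < n * p) :
    P {ω | ∃ i, ε < offDiagBound (M ω) i}
      ≤ ENNReal.ofReal (p * (((n * p : ℕ) : ℝ) ^ max r 1 * κ ^ 2 / ε ^ r)) := by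
  have hN' : (0 : ℝ) < ((n * p : ℕ) : ℝ) := by exact_mod_cast hN
  have h1 : ∀ i, P {ω | ε < offDiagBound (M ω) i}
      ≤ ENNReal.ofReal (((n * p : ℕ) : ℝ) ^ max r 1 * κ ^ 2 / ε ^ r) := by
    intro i
    have hm : AEMeasurable (fun ω => offDiagBound (M ω) i) P := by
      unfold offDiagBound
      refine Finset.aemeasurable_fun_sum _ fun k _ => Finset.aemeasurable_fun_sum _ fun t _ => ?_
      split_ifs
      · exact aemeasurable_const
      · exact (aemeasurable_entry hM i t).abs.mul (aemeasurable_entry hM k t).abs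
    have h2 := mul_meas_ge_le_lintegral₀ (hm.ennreal_ofReal.pow_const r) (ENNReal.ofReal ε ^ r)
    have h3 : P {ω | ε < offDiagBound (M ω) i}
        ≤ P {ω | ENNReal.ofReal ε ^ r ≤ ENNReal.ofReal (offDiagBound (M ω) i) ^ r} :=
      measure_mono fun ω (hω : ε < _) =>
        ENNReal.rpow_le_rpow (ENNReal.ofReal_le_ofReal hω.le) hr.le
    have h4 : ((n * p : ℕ) : ENNReal) ^ (max r 1 - 1) * (((n * p : ℕ) : ENNReal)
        * ENNReal.ofReal κ ^ 2) = ENNReal.ofReal (((n * p : ℕ) : ℝ) ^ max r 1 * κ ^ 2) := by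
      rw [← ENNReal.ofReal_natCast, ENNReal.ofReal_rpow_of_pos hN', ← ENNReal.ofReal_pow hκ,
        ← ENNReal.ofReal_mul hN'.le, ← ENNReal.ofReal_mul (by positivity), ← mul_assoc,
        Real.rpow_sub_one hN'.ne', div_mul_cancel₀ _ hN'.ne']
    rw [ENNReal.ofReal_div_of_pos (by positivity), ← h4,
      ENNReal.le_div_iff_mul_le (Or.inl (ENNReal.ofReal_pos.2 (by positivity)).ne')
        (Or.inl ENNReal.ofReal_ne_top), mul_comm,
      ← ENNReal.ofReal_rpow_of_pos hε]
    exact (mul_le_mul_right h3 _).trans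
      (h2.trans (lintegral_offDiagBound_rpow_le hM hindep hr hK i))
  have hset : {ω | ∃ i, ε < offDiagBound (M ω) i} = ⋃ i, {ω | ε < offDiagBound (M ω) i} := by
    ext; simp
  rw [hset]
  refine (measure_iUnion_fintype_le _ _).trans ((Finset.sum_le_sum fun i _ => h1 i).trans ?_)
  rw [Finset.sum_const, nsmul_eq_mul, Finset.card_univ, Fintype.card_fin,
    ENNReal.ofReal_mul (by positivity), ENNReal.ofReal_natCast]

/-- As `r` and `s` approach `α`, the right side tends to `2 - max α 1`. For `α ≤ 1` this is at least
`1 > β / (1 + β)`; for `α > 1` the strict inequality is equivalent to `β < (2 - α) / (α - 1)`. -/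
lemma exists_moment_exponents {α β : ℝ} (hα0 : 0 < α) (hβ0 : 0 < β)
    (hβ : 1 < α → β < (2 - α) / (α - 1)) :
    ∃ r s : ℝ, 0 < r ∧ r < α ∧ α < s ∧ β / (1 + β) < 2 * r / s - max r 1 := by
  have hlim : Tendsto (fun δ : ℝ => 2 * (α - δ) / (α + δ) - max (α - δ) 1) (𝓝[>] 0)
      (𝓝 (2 * (α - 0) / (α + 0) - max (α - 0) 1)) := by
    have : ContinuousAt (fun δ : ℝ => 2 * (α - δ) / (α + δ) - max (α - δ) 1) 0 := by
      apply ContinuousAt.sub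
      · exact ContinuousAt.div (by fun_prop) (by fun_prop) (by simpa using hα0.ne')
      · fun_prop
    exact this.tendsto.mono_left nhdsWithin_le_nhds
  have hlt : β / (1 + β) < 2 * (α - 0) / (α + 0) - max (α - 0) 1 := by
    rw [sub_zero, add_zero, mul_div_assoc, div_self hα0.ne', mul_one, div_lt_iff₀ (by linarith)]
    rcases le_or_gt α 1 with h | h
    · rw [max_eq_right h]; linarith
    · rw [max_eq_left h.le]
      have := hβ h
      rw [lt_div_iff₀ (by linarith)] at this
      nlinarith
  obtain ⟨δ, ⟨h1, h2⟩, h3⟩ := ((hlim.eventually_const_lt hlt).and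
    (nhdsWithin_le_nhds (eventually_lt_nhds hα0))).and self_mem_nhdsWithin |>.exists
  have h3' : 0 < δ := h3
  exact ⟨α - δ, α + δ, by linarith, by linarith, by linarith, h1⟩

/-- With `N = n * p n`, multiplying `p ≤ C n^β` by `p^β` gives `p^(1+β) ≤ C N^β`, hence `p =
O(N^(β/(1+β)))`. Together with `a N ^ s ≥ c N`, the expression is at most a constant times a
negative power of `N`. -/
lemma tendsto_dimension_mul_rpow {p : ℕ → ℕ} (hp : Tendsto p atTop atTop) {a : ℕ → ℝ}
    {β r s c κ η : ℝ} (hβ0 : 0 < β) (hpβ : (fun n => (p n : ℝ)) =O[atTop] (fun n : ℕ => (n : ℝ) ^ β))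
    (hr : 0 < r) (hs : 0 < s) (hθ : β / (1 + β) < 2 * r / s - max r 1) (hc : 0 < c) (hη : 0 < η)
    (ha : ∀ᶠ m : ℕ in atTop, 0 < a m ∧ c * m ≤ a m ^ s) :
    Tendsto (fun n : ℕ => (p n : ℝ) * (((n * p n : ℕ) : ℝ) ^ max r 1 * κ ^ 2
      / (a (n * p n) ^ 2 * η) ^ r)) atTop (𝓝 0) := by
  obtain ⟨C, hC0, hC⟩ := hpβ.exists_pos
  rw [Asymptotics.isBigOWith_iff] at hC
  have hN : Tendsto (fun n : ℕ => n * p n) atTop atTop := tendsto_id.atTop_mul_atTop₀ hp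
  set q := β / (1 + β) with hq
  have hNR : Tendsto (fun n : ℕ => ((n * p n : ℕ) : ℝ)) atTop atTop :=
    tendsto_natCast_atTop_atTop.comp hN
  have hlim : Tendsto (fun n : ℕ => (C ^ (1 / (1 + β)) * κ ^ 2 / (c ^ (2 * r / s) * η ^ r))
      * ((n * p n : ℕ) : ℝ) ^ (-(2 * r / s - max r 1 - q))) atTop (𝓝 0) := by
    have := ((tendsto_rpow_neg_atTop (y := 2 * r / s - max r 1 - q) (by linarith)).comp
      hNR).const_mul (C ^ (1 / (1 + β)) * κ ^ 2 / (c ^ (2 * r / s) * η ^ r))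
    rw [mul_zero] at this
    exact this
  refine tendsto_of_tendsto_of_tendsto_of_le_of_le' tendsto_const_nhds hlim ?_ ?_
  · filter_upwards [hN.eventually ha] with n hn
    have := hn.1
    positivity
  · filter_upwards [hN.eventually ha, hC, hp.eventually_gt_atTop 0, eventually_gt_atTop 0]
      with n ⟨ha0, han⟩ hpn hp0 hn0
    have hn0' : (0 : ℝ) < n := by exact_mod_cast hn0
    have hp0' : (0 : ℝ) < p n := by exact_mod_cast hp0
    rw [Real.norm_of_nonneg hp0'.le, Real.norm_of_nonneg (by positivity)] at hpn
    set N : ℝ := ((n * p n : ℕ) : ℝ) with hNdef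
    have hNeq : N = n * p n := by rw [hNdef]; push_cast; ring
    have hN0 : 0 < N := by rw [hNeq]; positivity
    have hpN : (p n : ℝ) ≤ C ^ (1 / (1 + β)) * N ^ q := by
      have h1 : (p n : ℝ) ^ (1 + β) ≤ C * N ^ β := by
        rw [Real.rpow_add hp0', Real.rpow_one, hNeq, Real.mul_rpow hn0'.le hp0'.le, ← mul_assoc]
        exact mul_le_mul_of_nonneg_right hpn (by positivity)
      have h2 := Real.rpow_le_rpow (by positivity) h1 (by positivity : 0 ≤ 1 / (1 + β))
      rw [← Real.rpow_mul hp0'.le, mul_one_div_cancel (by positivity), Real.rpow_one,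
        Real.mul_rpow hC0.le (by positivity), ← Real.rpow_mul hN0.le, mul_one_div] at h2
      exact h2
    have hden : c ^ (2 * r / s) * η ^ r * N ^ (2 * r / s) ≤ (a (n * p n) ^ 2 * η) ^ r := by
      have h1 : (c * N) ^ (2 * r / s) ≤ (a (n * p n) ^ s) ^ (2 * r / s) :=
        Real.rpow_le_rpow (by positivity) han (by positivity)
      rw [← Real.rpow_mul ha0.le, mul_div_cancel₀ _ hs.ne', Real.mul_rpow hc.le hN0.le] at h1
      rw [Real.mul_rpow (by positivity) hη.le, ← Real.rpow_natCast, ← Real.rpow_mul ha0.le]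
      push_cast
      calc c ^ (2 * r / s) * η ^ r * N ^ (2 * r / s)
          = (c ^ (2 * r / s) * N ^ (2 * r / s)) * η ^ r := by ring
        _ ≤ _ := mul_le_mul_of_nonneg_right h1 (by positivity)
    calc (p n : ℝ) * (N ^ max r 1 * κ ^ 2 / (a (n * p n) ^ 2 * η) ^ r)
        ≤ (C ^ (1 / (1 + β)) * N ^ q) * (N ^ max r 1 * κ ^ 2
            / (c ^ (2 * r / s) * η ^ r * N ^ (2 * r / s))) := by
          refine mul_le_mul hpN ?_ (by positivity) (by positivity)
          exact div_le_div_of_nonneg_left (by positivity) (by positivity) hden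
      _ = (C ^ (1 / (1 + β)) * κ ^ 2 / (c ^ (2 * r / s) * η ^ r))
            * (N ^ q * N ^ max r 1 / N ^ (2 * r / s)) := by field_simp
      _ = _ := by
          rw [← Real.rpow_add hN0, ← Real.rpow_sub hN0]
          congr 2
          ring

end OffDiagonal

/-! ### Joint law of the Poisson arrival times. -/

section Arrivals

/-- Increasing vectors with entries in `[0, s]`. -/
def orderedSimplex (m : ℕ) (s : ℝ) : Set (Fin m → ℝ) :=
  {u | Monotone u ∧ ∀ i, 0 ≤ u i ∧ u i ≤ s}

lemma measurableSet_monotone (m : ℕ) : MeasurableSet {u : Fin m → ℝ | Monotone u} := by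
  have : {u : Fin m → ℝ | Monotone u} = ⋂ i, ⋂ j, {u | i ≤ j → u i ≤ u j} := by
    ext u
    simp [Monotone]
  rw [this]
  refine MeasurableSet.iInter fun i => MeasurableSet.iInter fun j => ?_
  by_cases h : i ≤ j
  · simp only [h, forall_const]
    exact measurableSet_le (measurable_pi_apply i) (measurable_pi_apply j)
  · simp [h]

lemma measurableSet_orderedSimplex_prod (m : ℕ) :
    MeasurableSet {z : (Fin m → ℝ) × ℝ | z.1 ∈ orderedSimplex m z.2} := by
  have : {z : (Fin m → ℝ) × ℝ | z.1 ∈ orderedSimplex m z.2}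
      = (Prod.fst ⁻¹' {u : Fin m → ℝ | Monotone u})
        ∩ ⋂ i, ({z | 0 ≤ z.1 i} ∩ {z | z.1 i ≤ z.2}) := by
    ext z
    simp [orderedSimplex]
  rw [this]
  refine (measurable_fst (measurableSet_monotone m)).inter (MeasurableSet.iInter fun i => ?_)
  exact (measurableSet_le measurable_const ((measurable_pi_apply i).comp measurable_fst)).inter
    (measurableSet_le ((measurable_pi_apply i).comp measurable_fst) measurable_snd)

lemma measurableSet_orderedSimplex (m : ℕ) (s : ℝ) : MeasurableSet (orderedSimplex m s) :=
  measurable_prodMk_right (y := s) (measurableSet_orderedSimplex_prod m)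

lemma snoc_mem_orderedSimplex {m : ℕ} (u : Fin m → ℝ) (t s : ℝ) :
    (Fin.snoc u t : Fin (m + 1) → ℝ) ∈ orderedSimplex (m + 1) s
      ↔ u ∈ orderedSimplex m t ∧ 0 ≤ t ∧ t ≤ s := by
  constructor
  · rintro ⟨hm, hb⟩
    have hl := hb (Fin.last m)
    rw [Fin.snoc_last] at hl
    refine ⟨⟨fun i j hij => ?_, fun i => ⟨?_, ?_⟩⟩, hl⟩
    · have := hm (Fin.castSucc_le_castSucc_iff.2 hij)
      simpa using this
    · have := (hb i.castSucc).1
      simpa using this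
    · have := hm (Fin.le_last i.castSucc)
      simpa using this
  · rintro ⟨⟨hm, hb⟩, h0, h1⟩
    refine ⟨fun i j => ?_, fun i => ?_⟩
    · refine Fin.lastCases ?_ (fun j => ?_) j
      · refine Fin.lastCases ?_ (fun i => ?_) i
        · simp
        · simpa using fun _ => (hb i).2
      · refine Fin.lastCases ?_ (fun i => ?_) i
        · intro h
          exact absurd h (not_le.2 (Fin.castSucc_lt_last j))
        · intro h
          simpa using hm (Fin.castSucc_le_castSucc_iff.1 h)
    · refine Fin.lastCases ?_ (fun i => ?_) i
      · simp [h0, h1]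
      · simpa using ⟨(hb i).1, (hb i).2.trans h1⟩

lemma measurable_snoc (m : ℕ) :
    Measurable fun z : (Fin m → ℝ) × ℝ => (Fin.snoc z.1 z.2 : Fin (m + 1) → ℝ) := by
  refine measurable_pi_iff.2 fun i => ?_
  refine Fin.lastCases ?_ (fun i => ?_) i
  · simpa using measurable_snd
  · simpa using! (measurable_pi_apply i).comp measurable_fst

lemma lintegral_snoc {m : ℕ} {F : (Fin (m + 1) → ℝ) → ENNReal} (hF : Measurable F) :
    ∫⁻ u, F u = ∫⁻ t, ∫⁻ u, F (Fin.snoc u t) := by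
  have h := (volume_preserving_piFinSuccAbove (fun _ : Fin (m + 1) => ℝ) (Fin.last m)).symm
  rw [← h.lintegral_comp hF, Measure.volume_eq_prod, lintegral_prod _ (by
    exact (hF.comp (MeasurableEquiv.measurable _)).aemeasurable)]
  refine lintegral_congr fun t => ?_
  refine lintegral_congr fun u => ?_
  congr 1
  exact Fin.insertNth_last' t u

lemma exponentialPDF_one_eq (x : ℝ) : exponentialPDF 1 x
    = if 0 ≤ x then ENNReal.ofReal (Real.exp (-x)) else 0 := by
  rw [exponentialPDF_eq]
  split_ifs <;> simp

/-- Because `exp (-t) * exp (-(s - t)) = exp (-s)`, the joint density depends on the last arrival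
only: given it, the earlier arrivals are uniform on the ordered simplex. -/
lemma exponentialPDF_mul_simplex {m : ℕ} (u : Fin m → ℝ) (t s : ℝ) :
    exponentialPDF 1 t * ((orderedSimplex m t).indicator 1 u * exponentialPDF 1 (s - t))
      = exponentialPDF 1 s
        * (orderedSimplex (m + 1) s).indicator (1 : (Fin (m + 1) → ℝ) → ENNReal)
          (Fin.snoc u t : Fin (m + 1) → ℝ) := by
  classical
  simp only [Set.indicator_apply, snoc_mem_orderedSimplex, exponentialPDF_one_eq, sub_nonneg,
    Pi.one_apply]
  by_cases h1 : u ∈ orderedSimplex m t <;> by_cases h2 : 0 ≤ t <;> by_cases h3 : t ≤ s <;>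
    simp [h1, h2, h3]
  rw [if_pos (h2.trans h3), ← ENNReal.ofReal_mul (Real.exp_pos _).le, ← Real.exp_add]
  congr 2
  ring

variable {Ω : Type*} {E : ℕ → Ω → ℝ}

lemma arrival_succ (E : ℕ → Ω → ℝ) (m : ℕ) (ω : Ω) :
    arrival E (m + 1) ω = arrival E m ω + E (m + 1) ω :=
  Finset.sum_range_succ _ _

variable [MeasurableSpace Ω] {Q : Measure Ω}

lemma aemeasurable_arrival (hE : ∀ k, HasLaw (E k) (expMeasure 1) Q) (i : ℕ) :
    AEMeasurable (arrival E i) Q :=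
  Finset.aemeasurable_fun_sum _ fun k _ => (hE k).aemeasurable

lemma aemeasurable_arrivals (hE : ∀ k, HasLaw (E k) (expMeasure 1) Q) (m : ℕ) :
    AEMeasurable (fun ω => ((fun i : Fin m => arrival E i ω), arrival E m ω)) Q :=
  (aemeasurable_pi_iff.2 fun i : Fin m => aemeasurable_arrival hE i).prodMk (aemeasurable_arrival hE m)

lemma lintegral_expMeasure {f : ℝ → ENNReal} (hf : Measurable f) :
    ∫⁻ x, f x ∂(expMeasure 1) = ∫⁻ x, exponentialPDF 1 x * f x := by
  have hm : Measurable (exponentialPDF 1) := (measurable_exponentialPDFReal 1).ennreal_ofReal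
  exact lintegral_withDensity_eq_lintegral_mul _ hm hf

lemma indepFun_arrivals (hE : ∀ k, HasLaw (E k) (expMeasure 1) Q) (hind : iIndepFun E Q) (m : ℕ) :
    IndepFun (fun ω => ((fun i : Fin m => arrival E i ω), arrival E m ω)) (E (m + 1)) Q := by
  have h := hind.indepFun_finset₀ (Finset.range (m + 1)) {m + 1} (by simp)
    (fun k => (hE k).aemeasurable)
  let part : (Finset.range (m + 1) → ℝ) → ℕ → ℝ := fun v i =>
    ∑ k : Finset.range (m + 1), if (k : ℕ) < i + 1 then v k else 0
  have hpart : ∀ i, Measurable fun v => part v i := fun i =>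
    Finset.measurable_fun_sum _ fun k _ => by
      split_ifs
      · exact measurable_pi_apply k
      · exact measurable_const
  have hpart_eq : ∀ i, i ≤ m → ∀ ω, part (fun k => E k ω) i = arrival E i ω := by
    intro i hi ω
    simp only [part, arrival]
    rw [Finset.sum_coe_sort (Finset.range (m + 1)) (fun k => if k < i + 1 then E k ω else 0),
      ← Finset.sum_filter]
    congr 1
    ext k
    simp only [Finset.mem_filter, Finset.mem_range]
    omega
  have hφ : Measurable fun v => ((fun i : Fin m => part v i), part v m) :=
    (measurable_pi_iff.2 fun i : Fin m => hpart i).prodMk (hpart m)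
  have hψ : Measurable fun v : ({m + 1} : Finset ℕ) → ℝ => v ⟨m + 1, by simp⟩ :=
    measurable_pi_apply _
  have h' := h.comp hφ hψ
  convert! h' using 1
  ext ω
  · simp only [Function.comp]
    rw [hpart_eq _ (by omega)]
  · simp only [Function.comp]
    rw [hpart_eq _ le_rfl]

/-- The joint law of the first arrivals. -/
lemma lintegral_arrivals [IsProbabilityMeasure Q]
    (hE : ∀ k, HasLaw (E k) (expMeasure 1) Q) (hind : iIndepFun E Q) (m : ℕ)
    {H : (Fin m → ℝ) × ℝ → ENNReal} (hH : Measurable H) :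
    ∫⁻ ω, H ((fun i : Fin m => arrival E i ω), arrival E m ω) ∂Q
      = ∫⁻ s, exponentialPDF 1 s * ∫⁻ u, (orderedSimplex m s).indicator 1 u * H (u, s) := by
  have hpdf : Measurable (exponentialPDF 1) := (measurable_exponentialPDFReal 1).ennreal_ofReal
  induction m with
  | zero =>
    have h1 : ∀ ω, H ((fun i : Fin 0 => arrival E i ω), arrival E 0 ω)
        = (fun s => H (0, s)) (E 0 ω) := by
      intro ω
      simp only [arrival, zero_add, Finset.sum_range_one]
      congr 2
      exact Subsingleton.elim _ _
    have hH0 : Measurable fun s => H (0, s) := hH.comp measurable_prodMk_left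
    simp_rw [h1]
    rw [(hE 0).lintegral_comp hH0.aemeasurable, lintegral_expMeasure hH0]
    refine lintegral_congr fun s => ?_
    rw [Measure.volume_pi_eq_dirac 0, lintegral_dirac, Set.indicator_of_mem]
    · simp
    · exact ⟨fun i => i.elim0, fun i => i.elim0⟩
  | succ m ih =>
    set K : ((Fin m → ℝ) × ℝ) × ℝ → ENNReal := fun z => H (Fin.snoc z.1.1 z.1.2, z.2) with hK
    have hKm : Measurable K :=
      hH.comp (((measurable_snoc m).comp measurable_fst).prodMk measurable_snd)
    have h1 : ∀ ω, H ((fun i : Fin (m + 1) => arrival E i ω), arrival E (m + 1) ω)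
        = (fun z : ((Fin m → ℝ) × ℝ) × ℝ => K (z.1, z.1.2 + z.2))
          (((fun i : Fin m => arrival E i ω), arrival E m ω), E (m + 1) ω) := by
      intro ω
      simp only [hK, arrival_succ]
      congr 2
      ext i
      refine Fin.lastCases ?_ (fun i => ?_) i <;> simp
    have hK1 : Measurable fun z : ((Fin m → ℝ) × ℝ) × ℝ => K (z.1, z.1.2 + z.2) :=
      hKm.comp (measurable_fst.prodMk
        ((measurable_snd.comp measurable_fst).add measurable_snd))
    have : IsProbabilityMeasure (expMeasure 1) := isProbabilityMeasure_expMeasure one_pos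
    have hlaw : HasLaw (fun ω => ((fun i : Fin m => arrival E i ω), arrival E m ω))
        (Q.map fun ω => ((fun i : Fin m => arrival E i ω), arrival E m ω)) Q :=
      ⟨aemeasurable_arrivals hE m, rfl⟩
    have hprod := (indepFun_iff_hasLaw_prodMk_prod hlaw (hE (m + 1))).1
      (indepFun_arrivals hE hind m)
    have : IsProbabilityMeasure (Q.map fun ω => ((fun i : Fin m => arrival E i ω),
      arrival E m ω)) := Measure.isProbabilityMeasure_map (aemeasurable_arrivals hE m)
    simp_rw [h1]
    rw [hprod.lintegral_comp hK1.aemeasurable, lintegral_prod _ hK1.aemeasurable]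
    -- The new exponential is replaced by the new last arrival `s`. The old last arrival then turns
    -- into the last coordinate of a point of the next simplex.
    set J : (Fin m → ℝ) × ℝ → ENNReal := fun w => ∫⁻ s, exponentialPDF 1 (s - w.2) * K (w, s)
      with hJ
    have hJm : Measurable J := by
      refine Measurable.lintegral_prod_right' (f := fun z : ((Fin m → ℝ) × ℝ) × ℝ =>
        exponentialPDF 1 (z.2 - z.1.2) * K z) ?_
      exact (hpdf.comp (measurable_snd.sub (measurable_snd.comp measurable_fst))).mul hKm
    have h2 : ∀ w : (Fin m → ℝ) × ℝ, ∫⁻ e, K (w, w.2 + e) ∂(expMeasure 1) = J w := by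
      intro w
      have hKw : Measurable fun e => K (w, w.2 + e) :=
        hKm.comp (measurable_const.prodMk (measurable_const_add _))
      rw [lintegral_expMeasure hKw, hJ]
      refine Eq.trans (lintegral_congr fun e => ?_) (lintegral_add_left_eq_self (μ := volume)
        (fun s => exponentialPDF 1 (s - w.2) * K (w, s)) w.2)
      simp
    refine (lintegral_congr fun w => h2 w).trans ?_
    rw [lintegral_map' hJm.aemeasurable (aemeasurable_arrivals hE m), ih hJm]
    have hsx : ∀ k, Measurable fun z : (Fin k → ℝ) × ℝ =>
        (orderedSimplex k z.2).indicator (1 : (Fin k → ℝ) → ENNReal) z.1 := fun k =>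
      (measurable_one (α := ENNReal)).indicator (measurableSet_orderedSimplex_prod k)
    have hsx' : ∀ k s, Measurable
        ((orderedSimplex k s).indicator (1 : (Fin k → ℝ) → ENNReal)) := fun k s =>
      measurable_one.indicator (measurableSet_orderedSimplex k s)
    calc ∫⁻ t, exponentialPDF 1 t * ∫⁻ u, (orderedSimplex m t).indicator 1 u * J (u, t)
        = ∫⁻ t, ∫⁻ u, ∫⁻ s, exponentialPDF 1 s
            * (orderedSimplex (m + 1) s).indicator (1 : (Fin (m + 1) → ℝ) → ENNReal)
              (Fin.snoc u t : Fin (m + 1) → ℝ) * H (Fin.snoc u t, s) := by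
          refine lintegral_congr fun t => ?_
          have hJt : Measurable fun u => (orderedSimplex m t).indicator 1 u * J (u, t) :=
            (hsx' m t).mul (hJm.comp measurable_prodMk_right)
          rw [← lintegral_const_mul _ hJt]
          refine lintegral_congr fun u => ?_
          have hm1 : Measurable fun s => exponentialPDF 1 (s - t) * K ((u, t), s) :=
            (hpdf.comp (measurable_id.sub measurable_const)).mul
              (hKm.comp measurable_prodMk_left)
          rw [hJ, ← lintegral_const_mul _ hm1, ← lintegral_const_mul _ (hm1.const_mul _)]
          refine lintegral_congr fun s => ?_
          rw [← exponentialPDF_mul_simplex]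
          simp only [hK]
          ring
      _ = ∫⁻ s, ∫⁻ t, ∫⁻ u, exponentialPDF 1 s
            * (orderedSimplex (m + 1) s).indicator (1 : (Fin (m + 1) → ℝ) → ENNReal)
              (Fin.snoc u t : Fin (m + 1) → ℝ) * H (Fin.snoc u t, s) := by
          have hbig : Measurable fun z : (ℝ × (Fin m → ℝ)) × ℝ => exponentialPDF 1 z.2
            * (orderedSimplex (m + 1) z.2).indicator (1 : (Fin (m + 1) → ℝ) → ENNReal)
              (Fin.snoc z.1.2 z.1.1 : Fin (m + 1) → ℝ) * H (Fin.snoc z.1.2 z.1.1, z.2) := by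
            have hs : Measurable fun z : (ℝ × (Fin m → ℝ)) × ℝ =>
                ((Fin.snoc z.1.2 z.1.1 : Fin (m + 1) → ℝ), z.2) :=
              ((measurable_snoc m).comp (measurable_swap.comp measurable_fst)).prodMk
                measurable_snd
            exact ((hpdf.comp measurable_snd).mul ((hsx (m + 1)).comp hs)).mul (hH.comp hs)
          rw [← lintegral_prod (f := fun z : ℝ × (Fin m → ℝ) => ∫⁻ s, exponentialPDF 1 s
            * (orderedSimplex (m + 1) s).indicator (1 : (Fin (m + 1) → ℝ) → ENNReal)
              (Fin.snoc z.2 z.1 : Fin (m + 1) → ℝ) * H (Fin.snoc z.2 z.1, s))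
            (by exact hbig.lintegral_prod_right'.aemeasurable)]
          rw [lintegral_lintegral_swap hbig.aemeasurable]
          refine lintegral_congr fun s => ?_
          rw [lintegral_prod]
          exact (hbig.comp measurable_prodMk_right).aemeasurable
      _ = _ := by
          refine lintegral_congr fun s => ?_
          have hm2 : Measurable fun u : Fin (m + 1) → ℝ =>
              (orderedSimplex (m + 1) s).indicator 1 u * H (u, s) :=
            (hsx' _ _).mul (hH.comp measurable_prodMk_right)
          rw [← lintegral_const_mul _ hm2, lintegral_snoc (hm2.const_mul _)]
          simp only [mul_assoc]

end Arrivals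

/-! ### Rényi's representation of uniform order statistics. -/

section UniformOrderStatistics

lemma volume_apply_eq_apply {m : ℕ} {i j : Fin m} (hij : i ≠ j) :
    volume {u : Fin m → ℝ | u i = u j} = 0 := by
  let S : Submodule ℝ (Fin m → ℝ) :=
    LinearMap.ker (LinearMap.proj (R := ℝ) (φ := fun _ : Fin m => ℝ) i - LinearMap.proj j)
  have hS : (S : Set (Fin m → ℝ)) = {u | u i = u j} := by
    ext u
    simp [S, sub_eq_zero]
  rw [← hS]
  refine Measure.addHaar_submodule _ _ fun htop => ?_
  have : Pi.single i (1 : ℝ) ∈ S := htop ▸ Submodule.mem_top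
  rw [← SetLike.mem_coe, hS] at this
  simp [hij.symm] at this

lemma ae_injective (m : ℕ) : ∀ᵐ u : Fin m → ℝ, Function.Injective u := by
  have : ∀ᵐ u : Fin m → ℝ, ∀ i j, i ≠ j → u i ≠ u j := by
    rw [ae_all_iff]
    intro i
    rw [ae_all_iff]
    intro j
    by_cases hij : i = j
    · simp [hij]
    · have h0 := volume_apply_eq_apply hij
      rw [measure_eq_zero_iff_ae_notMem] at h0
      filter_upwards [h0] with u hu _ using hu
  filter_upwards [this] with u hu i j hij
  by_contra hne
  exact hu i j hne hij

/-- A vector with distinct entries is sorted by exactly one permutation, so the permuted simplices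
tile the cube up to a null set. -/
lemma sum_perm_indicator_simplex {m : ℕ} {u : Fin m → ℝ} (hu : Function.Injective u) :
    ∑ σ : Equiv.Perm (Fin m), (orderedSimplex m 1).indicator (1 : (Fin m → ℝ) → ENNReal)
      (fun i => u (σ i)) = (Set.univ.pi fun _ => Set.Icc 0 1).indicator 1 u := by
  classical
  rw [Finset.sum_eq_single (Tuple.sort u)]
  · by_cases h : u ∈ Set.univ.pi fun _ => Set.Icc (0 : ℝ) 1
    · rw [Set.indicator_of_mem h, Set.indicator_of_mem]
      · rfl
      · exact ⟨Tuple.monotone_sort u, fun i => h _ (Set.mem_univ _)⟩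
    · rw [Set.indicator_of_notMem h, Set.indicator_of_notMem]
      intro hs
      refine h fun i _ => ?_
      have := hs.2 ((Tuple.sort u).symm i)
      simpa using this
  · intro σ _ hσ
    refine Set.indicator_of_notMem (fun hs => hσ ?_) _
    have h1 := Tuple.unique_monotone (f := u) (σ := σ) (τ := Tuple.sort u) hs.1
      (Tuple.monotone_sort u)
    ext i
    exact congrArg Fin.val (hu (congrFun h1 i))
  · simp

lemma lintegral_comp_perm {m : ℕ} (σ : Equiv.Perm (Fin m)) (F : (Fin m → ℝ) → ENNReal) :
    ∫⁻ u : Fin m → ℝ, F (fun i => u (σ i)) = ∫⁻ u, F u := by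
  have h := volume_measurePreserving_piCongrLeft (fun _ : Fin m => ℝ) σ.symm
  refine Eq.trans (lintegral_congr fun u => ?_) (h.lintegral_map_equiv F _).symm
  congr 1
  ext i
  have := MeasurableEquiv.piCongrLeft_apply_apply (β := fun _ : Fin m => ℝ) σ.symm u (σ i)
  simpa using this.symm

lemma lintegral_cube_eq {m : ℕ} {h : (Fin m → ℝ) → ENNReal} (hm : Measurable h)
    (hsymm : ∀ (σ : Equiv.Perm (Fin m)) u, h (fun i => u (σ i)) = h u) :
    ∫⁻ u, h u ∂(Measure.pi fun _ : Fin m => (volume : Measure ℝ).restrict (Set.Icc 0 1))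
      = Fintype.card (Equiv.Perm (Fin m))
        * ∫⁻ u, (orderedSimplex m 1).indicator 1 u * h u := by
  have hms : Measurable ((orderedSimplex m 1).indicator (1 : (Fin m → ℝ) → ENNReal)) :=
    measurable_one.indicator (measurableSet_orderedSimplex m 1)
  have hbox : MeasurableSet (Set.univ.pi fun _ : Fin m => Set.Icc (0 : ℝ) 1) :=
    MeasurableSet.univ_pi fun _ => measurableSet_Icc
  rw [← Measure.restrict_pi_pi, ← volume_pi, ← lintegral_indicator hbox]
  calc ∫⁻ u, (Set.univ.pi fun _ : Fin m => Set.Icc (0 : ℝ) 1).indicator h u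
      = ∫⁻ u : Fin m → ℝ, ∑ σ : Equiv.Perm (Fin m),
          (fun v => (orderedSimplex m 1).indicator 1 v * h v) (fun i => u (σ i)) := by
        refine lintegral_congr_ae ?_
        filter_upwards [ae_injective m] with u hu
        simp only [hsymm]
        rw [← Finset.sum_mul, sum_perm_indicator_simplex hu]
        by_cases hb : u ∈ Set.univ.pi fun _ : Fin m => Set.Icc (0 : ℝ) 1
        · rw [Set.indicator_of_mem hb, Set.indicator_of_mem hb]; simp
        · rw [Set.indicator_of_notMem hb, Set.indicator_of_notMem hb]; simp
    _ = ∑ σ : Equiv.Perm (Fin m), ∫⁻ u : Fin m → ℝ,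
          (fun v => (orderedSimplex m 1).indicator 1 v * h v) (fun i => u (σ i)) := by
        refine lintegral_finsetSum _ fun σ _ => ?_
        have hF : Measurable fun v => (orderedSimplex m 1).indicator 1 v * h v := hms.mul hm
        exact hF.comp (measurable_pi_iff.2 fun i => measurable_pi_apply (σ i))
    _ = _ := by
        simp only [lintegral_comp_perm _ fun v => (orderedSimplex m 1).indicator 1 v * h v]
        rw [Finset.sum_const, nsmul_eq_mul, Finset.card_univ]

variable {Ω : Type*} [MeasurableSpace Ω] {Q : Measure Ω} [IsProbabilityMeasure Q] {E : ℕ → Ω → ℝ}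

lemma inv_smul_mem_orderedSimplex {m : ℕ} {s : ℝ} (hs : 0 < s) (u : Fin m → ℝ) :
    s⁻¹ • u ∈ orderedSimplex m 1 ↔ u ∈ orderedSimplex m s := by
  simp only [orderedSimplex, Set.mem_ofPred_eq, Monotone, Pi.smul_apply, smul_eq_mul]
  have hs' : 0 < s⁻¹ := inv_pos.2 hs
  simp only [mul_le_mul_iff_right₀ hs', mul_nonneg_iff_of_pos_left hs', inv_mul_le_iff₀ hs, mul_one]

lemma lintegral_simplex_scale {m : ℕ} {s : ℝ} (hs : 0 < s) {h : (Fin m → ℝ) → ENNReal}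
    (hm : Measurable h) :
    ∫⁻ u, (orderedSimplex m s).indicator 1 u * h (s⁻¹ • u)
      = ENNReal.ofReal |(s⁻¹ ^ m)⁻¹| * ∫⁻ u, (orderedSimplex m 1).indicator 1 u * h u := by
  have hms : Measurable fun u => (orderedSimplex m 1).indicator 1 u * h u :=
    (measurable_one.indicator (measurableSet_orderedSimplex m 1)).mul hm
  have h1 := Measure.map_addHaar_smul (volume : Measure (Fin m → ℝ)) (inv_ne_zero hs.ne')
  rw [Module.finrank_fin_fun] at h1
  rw [← smul_eq_mul, ← lintegral_smul_measure, ← h1, lintegral_map hms (by fun_prop)]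
  refine lintegral_congr fun u => ?_
  classical
  simp only [Set.indicator_apply, inv_smul_mem_orderedSimplex hs, Pi.one_apply]

/-- The order statistics of independent uniform random variables have the law of the normalized
arrival times of a Poisson process. -/
theorem lintegral_uniform_eq_arrivals (hE : ∀ k, HasLaw (E k) (expMeasure 1) Q)
    (hind : iIndepFun E Q) {m : ℕ} {h : (Fin m → ℝ) → ENNReal} (hm : Measurable h)
    (hsymm : ∀ (σ : Equiv.Perm (Fin m)) u, h (fun i => u (σ i)) = h u) :
    ∫⁻ u, h u ∂(Measure.pi fun _ : Fin m => (volume : Measure ℝ).restrict (Set.Icc 0 1))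
      = ∫⁻ ω, h (fun i => (arrival E m ω)⁻¹ * arrival E i ω) ∂Q := by
  -- By scaling, the last arrival contributes a factor `c` independent of the integrand. Its value
  -- `m!` is found below by testing against the constant `1`, without evaluating the integral.
  set c : ENNReal := ∫⁻ s, exponentialPDF 1 s * ENNReal.ofReal |(s⁻¹ ^ m)⁻¹| with hc
  have key : ∀ {g : (Fin m → ℝ) → ENNReal}, Measurable g →
      ∫⁻ ω, g (fun i => (arrival E m ω)⁻¹ * arrival E i ω) ∂Q
        = c * ∫⁻ u, (orderedSimplex m 1).indicator 1 u * g u := by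
    intro g hg
    have hH : Measurable fun z : (Fin m → ℝ) × ℝ => g (z.2⁻¹ • z.1) :=
      hg.comp (measurable_snd.inv.smul measurable_fst)
    have h1 := lintegral_arrivals hE hind m hH
    refine h1.trans ?_
    have hcm : Measurable fun s : ℝ => exponentialPDF 1 s * ENNReal.ofReal |(s⁻¹ ^ m)⁻¹| := by
      have : Measurable (exponentialPDF 1) := (measurable_exponentialPDFReal 1).ennreal_ofReal
      fun_prop
    rw [hc, ← lintegral_mul_const _ hcm]
    have h0 : ∀ᵐ s : ℝ, s ≠ 0 := Measure.ae_ne volume 0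
    refine lintegral_congr_ae ?_
    filter_upwards [h0] with s hs0
    rcases lt_or_gt_of_ne hs0 with hs | hs
    · simp [exponentialPDF_of_neg hs]
    · rw [mul_assoc, ← lintegral_simplex_scale hs hg]
  have hone := key (g := 1) measurable_one
  have hone' := lintegral_cube_eq (m := m) (h := 1) measurable_one (fun _ _ => rfl)
  have hprob : IsProbabilityMeasure ((volume : Measure ℝ).restrict (Set.Icc 0 1)) :=
    ⟨by simp⟩
  simp only [Pi.one_apply, mul_one, lintegral_one, measure_univ] at hone hone'
  set V : ENNReal := ∫⁻ u, (orderedSimplex m 1).indicator 1 u with hV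
  have hcc : c = Fintype.card (Equiv.Perm (Fin m)) := by
    calc c = c * (Fintype.card (Equiv.Perm (Fin m)) * V) := by rw [← hone', mul_one]
      _ = Fintype.card (Equiv.Perm (Fin m)) * (c * V) := by ring
      _ = _ := by rw [← hone, mul_one]
  rw [key hm, lintegral_cube_eq hm hsymm, hcc]

end UniformOrderStatistics

/-! ### The tail quantile transform and its asymptotics. -/

section Quantile

/-- The generalized inverse of the tail function `x ↦ ν (x, ∞)` on `[0, ∞)`. -/
noncomputable def tailQuantile (ν : Measure ℝ) (u : ℝ) : ℝ :=
  if 0 < u then sInf {x : ℝ | 0 ≤ x ∧ ν.real (Set.Ioi x) ≤ u} else 0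

variable {ν : Measure ℝ}

lemma tailQuantile_nonneg (ν : Measure ℝ) (u : ℝ) : 0 ≤ tailQuantile ν u := by
  unfold tailQuantile
  split_ifs
  · exact Real.sInf_nonneg fun _ hx => hx.1
  · exact le_rfl

lemma real_Ioi_eq_one_sub_cdf [IsProbabilityMeasure ν] (x : ℝ) :
    ν.real (Set.Ioi x) = 1 - cdf ν x := by
  rw [cdf_eq_real, ← Set.compl_Iic, probReal_compl_eq_one_sub measurableSet_Iic]

/-- The infimum is attained because the distribution function is right-continuous; `0 < u` is what
makes the defining set nonempty. -/
lemma tailQuantile_le_iff [IsProbabilityMeasure ν] {u x : ℝ} (hu : 0 < u) (hx : 0 ≤ x) :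
    tailQuantile ν u ≤ x ↔ ν.real (Set.Ioi x) ≤ u := by
  rw [tailQuantile, if_pos hu]
  constructor
  · intro h
    have hne : {x : ℝ | 0 ≤ x ∧ ν.real (Set.Ioi x) ≤ u}.Nonempty := by
      have h1 := (tendsto_cdf_atTop ν).eventually_const_lt (by linarith : 1 - u < 1)
      obtain ⟨y, hy, hy0⟩ := (h1.and (eventually_ge_atTop 0)).exists
      exact ⟨y, hy0, by rw [real_Ioi_eq_one_sub_cdf]; linarith⟩
    have hev : ∀ᶠ y in 𝓝[>] x, 1 - u ≤ cdf ν y := by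
      filter_upwards [self_mem_nhdsWithin] with y hy
      obtain ⟨z, hz, hzy⟩ := exists_lt_of_csInf_lt hne (lt_of_le_of_lt h hy)
      have := hz.2
      rw [real_Ioi_eq_one_sub_cdf] at this
      linarith [monotone_cdf ν hzy.le]
    have hc : Tendsto (cdf ν) (𝓝[>] x) (𝓝 (cdf ν x)) :=
      ((cdf ν).right_continuous x).tendsto.mono_left (nhdsWithin_mono _ Set.Ioi_subset_Ici_self)
    rw [real_Ioi_eq_one_sub_cdf]
    linarith [ge_of_tendsto hc hev]
  · intro h
    exact csInf_le ⟨0, fun y hy => hy.1⟩ ⟨hx, h⟩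

lemma antitoneOn_tailQuantile [IsProbabilityMeasure ν] :
    AntitoneOn (tailQuantile ν) (Set.Ioi 0) := by
  intro u hu v hv huv
  rw [tailQuantile_le_iff hv (tailQuantile_nonneg _ _)]
  exact ((tailQuantile_le_iff hu (tailQuantile_nonneg _ _)).1 le_rfl).trans huv

lemma tailQuantile_preimage_Iic [IsProbabilityMeasure ν] {x : ℝ} (hx : 0 ≤ x) :
    tailQuantile ν ⁻¹' Set.Iic x = Set.Iic 0 ∪ (Set.Ioi 0 ∩ Set.Ici (ν.real (Set.Ioi x))) := by
  ext u
  simp only [Set.mem_preimage, Set.mem_Iic, Set.mem_union, Set.mem_inter_iff, Set.mem_Ioi,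
    Set.mem_Ici]
  by_cases hu : 0 < u
  · simp [tailQuantile_le_iff hu hx, hu]
  · simp [tailQuantile, hu, hx, not_lt.1 hu]

lemma tailQuantile_preimage_Iic_of_neg {x : ℝ} (hx : x < 0) :
    tailQuantile ν ⁻¹' Set.Iic x = ∅ := by
  ext u
  simp only [Set.mem_preimage, Set.mem_Iic, Set.mem_empty_iff_false, iff_false, not_le]
  exact hx.trans_le (tailQuantile_nonneg _ _)

lemma measurable_tailQuantile [IsProbabilityMeasure ν] : Measurable (tailQuantile ν) := by
  refine measurable_of_Iic fun x => ?_
  rcases lt_or_ge x 0 with hx | hx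
  · rw [tailQuantile_preimage_Iic_of_neg hx]; exact MeasurableSet.empty
  · rw [tailQuantile_preimage_Iic hx]
    exact measurableSet_Iic.union (measurableSet_Ioi.inter measurableSet_Ici)

/-- Inverse transform sampling: up to the null point `0`, the event `tailQuantile ν u ≤ x` in `[0,
1]` is `[ν (x, ∞), 1]`, of length `cdf ν x`. -/
lemma map_tailQuantile [IsProbabilityMeasure ν] (h0 : ν (Set.Iio 0) = 0) :
    ((volume : Measure ℝ).restrict (Set.Icc 0 1)).map (tailQuantile ν) = ν := by
  have hprob : IsProbabilityMeasure ((volume : Measure ℝ).restrict (Set.Icc 0 1)) :=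
    ⟨by simp⟩
  have hprob' := Measure.isProbabilityMeasure_map
    (μ := (volume : Measure ℝ).restrict (Set.Icc 0 1)) (measurable_tailQuantile (ν := ν)).aemeasurable
  refine Measure.ext_of_Iic _ _ fun x => ?_
  rw [Measure.map_apply measurable_tailQuantile measurableSet_Iic]
  rcases lt_or_ge x 0 with hx | hx
  · rw [tailQuantile_preimage_Iic_of_neg hx, measure_empty]
    exact (measure_mono_null (fun y (hy : y ≤ x) => lt_of_le_of_lt hy hx) h0).symm
  · have hG0 : 0 ≤ ν.real (Set.Ioi x) := measureReal_nonneg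
    have hG1 : ν.real (Set.Ioi x) ≤ 1 := measureReal_le_one
    have hset : ((tailQuantile ν ⁻¹' Set.Iic x) ∩ Set.Icc 0 1 : Set ℝ)
        =ᵐ[volume] (Set.Icc (ν.real (Set.Ioi x)) 1 : Set ℝ) := by
      have hne : ∀ᵐ u : ℝ, u ≠ 0 := Measure.ae_ne volume 0
      filter_upwards [hne] with u hu
      rw [tailQuantile_preimage_Iic hx]
      apply propext
      change (u ∈ (Set.Iic 0 ∪ (Set.Ioi 0 ∩ Set.Ici (ν.real (Set.Ioi x)))) ∩ Set.Icc 0 1)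
        ↔ u ∈ Set.Icc (ν.real (Set.Ioi x)) 1
      simp only [Set.mem_inter_iff, Set.mem_union, Set.mem_Iic, Set.mem_Ioi, Set.mem_Ici,
        Set.mem_Icc]
      constructor
      · rintro ⟨h | h, h2, h3⟩
        · exact absurd (le_antisymm h h2) hu
        · exact ⟨h.2, h3⟩
      · rintro ⟨h1, h2⟩
        have : 0 ≤ u := hG0.trans h1
        exact ⟨Or.inr ⟨lt_of_le_of_ne this hu.symm, h1⟩, this, h2⟩
    rw [Measure.restrict_apply (measurable_tailQuantile measurableSet_Iic), measure_congr hset,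
      Real.volume_Icc, ← ofReal_cdf, real_Ioi_eq_one_sub_cdf]
    congr 1
    ring

/-- The limit `L` solves `b * L ^ (-(α / 2)) = v` when `b > 0`. Tail convergence at points on either
side of `L` traps the quantile; for `b = 0` one has `L = 0` and nonnegativity supplies the lower
bound. -/
lemma tendsto_tailQuantile {ι : Type*} {l : Filter ι} {ν : ι → Measure ℝ}
    (hν : ∀ n, IsProbabilityMeasure (ν n)) {p : ι → ℕ} {α b : ℝ} (hα : 0 < α) (hb : 0 ≤ b)
    (htail : ∀ x : ℝ, 0 < x →
      Tendsto (fun n => (p n : ℝ) * (ν n).real (Set.Ioi x)) l (𝓝 (b * x ^ (-(α / 2)))))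
    {u : ι → ℝ} (hu : ∀ᶠ n in l, 0 < u n) {v : ℝ} (hv : 0 < v)
    (huv : Tendsto (fun n => (p n : ℝ) * u n) l (𝓝 v)) :
    Tendsto (fun n => tailQuantile (ν n) (u n)) l (𝓝 (b ^ (2 / α) * v ^ (-(2 / α)))) := by
  set L := b ^ (2 / α) * v ^ (-(2 / α)) with hL
  have hL0 : 0 ≤ L := by positivity
  have hLpow : L ^ (α / 2) = b / v := by
    rw [hL, Real.mul_rpow (by positivity) (by positivity), ← Real.rpow_mul hb,
      ← Real.rpow_mul hv.le]
    have h1 : 2 / α * (α / 2) = 1 := by field_simp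
    have h2 : -(2 / α) * (α / 2) = -1 := by rw [neg_mul, h1]
    rw [h1, h2, Real.rpow_one, Real.rpow_neg_one, div_eq_mul_inv]
  rw [tendsto_order]
  constructor
  · intro y hy
    rcases lt_or_ge y 0 with hy0 | hy0
    · exact Eventually.of_forall fun n => hy0.trans_le (tailQuantile_nonneg _ _)
    · obtain ⟨x, hyx, hxL⟩ := exists_between hy
      have hx0 : 0 < x := hy0.trans_lt hyx
      have hlt : v < b * x ^ (-(α / 2)) := by
        have h1 : x ^ (α / 2) < L ^ (α / 2) := Real.rpow_lt_rpow hx0.le hxL (by positivity)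
        rw [hLpow, lt_div_iff₀ hv] at h1
        rw [Real.rpow_neg hx0.le, ← div_eq_mul_inv, lt_div_iff₀ (by positivity)]
        linarith
      filter_upwards [huv.eventually_lt (htail x hx0) hlt, hu] with n hn hun
      refine hyx.trans ?_
      rw [← not_le, tailQuantile_le_iff hun hx0.le, not_le]
      exact lt_of_mul_lt_mul_left hn (Nat.cast_nonneg _)
  · intro y hy
    obtain ⟨x, hLx, hxy⟩ := exists_between hy
    have hx0 : 0 < x := hL0.trans_lt hLx
    have hlt : b * x ^ (-(α / 2)) < v := by
      have h1 : L ^ (α / 2) < x ^ (α / 2) := Real.rpow_lt_rpow hL0 hLx (by positivity)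
      rw [hLpow, div_lt_iff₀ hv] at h1
      rw [Real.rpow_neg hx0.le, ← div_eq_mul_inv, div_lt_iff₀ (by positivity)]
      linarith
    filter_upwards [(htail x hx0).eventually_lt huv hlt, hu] with n hn hun
    refine lt_of_le_of_lt ?_ hxy
    rw [tailQuantile_le_iff hun hx0.le]
    exact (lt_of_mul_lt_mul_left hn (Nat.cast_nonneg _)).le

end Quantile

/-! ### Law of large numbers for the arrivals. -/

section ArrivalAsymptotics

variable {Ω : Type*} {E : ℕ → Ω → ℝ}

lemma strictMono_arrival {ω : Ω} (h : ∀ k, 0 < E k ω) : StrictMono fun i => arrival E i ω :=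
  strictMono_nat_of_lt_succ fun n => by
    rw [arrival_succ]
    linarith [h (n + 1)]

lemma arrival_pos {ω : Ω} (h : ∀ k, 0 < E k ω) (i : ℕ) : 0 < arrival E i ω :=
  Finset.sum_pos (fun k _ => h k) ⟨0, by simp⟩

variable [MeasurableSpace Ω] {Q : Measure Ω}

lemma ae_forall_exponential_pos (hE : ∀ k, HasLaw (E k) (expMeasure 1) Q) :
    ∀ᵐ ω ∂Q, ∀ k, 0 < E k ω := by
  rw [ae_all_iff]
  intro k
  have hprob : IsProbabilityMeasure (expMeasure 1) := isProbabilityMeasure_expMeasure one_pos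
  have h0 : expMeasure 1 (Set.Iic 0) = 0 := by
    rw [← ofReal_cdf, cdf_expMeasure_eq one_pos]
    simp
  have h1 : ∀ᵐ x ∂(expMeasure 1), 0 < x := by
    rw [measure_eq_zero_iff_ae_notMem] at h0
    filter_upwards [h0] with x hx
    simpa using hx
  rw [← (hE k).map_eq] at h1
  exact ae_of_ae_map (hE k).aemeasurable h1

lemma integral_expMeasure_id : Integrable id (expMeasure 1) ∧ ∫ x, x ∂(expMeasure 1) = 1 := by
  have hpdf : Measurable (exponentialPDF 1) := (measurable_exponentialPDFReal 1).ennreal_ofReal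
  have hfin : ∀ᵐ x : ℝ, exponentialPDF 1 x < ⊤ := Eventually.of_forall fun x =>
    ENNReal.ofReal_lt_top
  -- The first moment is written as the integral defining the Gamma function at `2`.
  have heq : (fun x => (exponentialPDF 1 x).toReal • x)
      = (Set.Ioi 0).indicator fun x => Real.exp (-x) * x ^ ((2 : ℝ) - 1) := by
    ext x
    rw [exponentialPDF_one_eq]
    rcases lt_trichotomy x 0 with hx | hx | hx
    · simp [hx.not_ge, hx.le]
    · simp [hx]
    · have h1 : (2 : ℝ) - 1 = 1 := by norm_num
      rw [if_pos hx.le, Set.indicator_of_mem (Set.mem_Ioi.2 hx), h1, Real.rpow_one,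
        ENNReal.toReal_ofReal (Real.exp_pos _).le, smul_eq_mul]
  have hE : expMeasure 1 = volume.withDensity (exponentialPDF 1) := rfl
  constructor
  · rw [hE, integrable_withDensity_iff_integrable_smul' hpdf hfin]
    simp only [id]
    rw [heq, integrable_indicator_iff measurableSet_Ioi]
    exact Real.GammaIntegral_convergent two_pos
  · rw [hE, integral_withDensity_eq_integral_toReal_smul hpdf hfin, heq,
      integral_indicator measurableSet_Ioi, ← Real.Gamma_eq_integral two_pos, Real.Gamma_two]

lemma ae_tendsto_arrival_div [IsProbabilityMeasure Q]
    (hE : ∀ k, HasLaw (E k) (expMeasure 1) Q) (hind : iIndepFun E Q) :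
    ∀ᵐ ω ∂Q, Tendsto (fun m : ℕ => arrival E m ω / m) atTop (𝓝 1) := by
  have hint : Integrable (E 0) Q := by
    have h := integral_expMeasure_id.1
    rw [← (hE 0).map_eq] at h
    exact (integrable_map_measure aestronglyMeasurable_id (hE 0).aemeasurable).1 h
  have hmean : Q[E 0] = 1 := by
    rw [(hE 0).integral_eq]
    exact integral_expMeasure_id.2
  have hlln := strong_law_ae_real E hint (fun i j hij => hind.indepFun hij)
    (fun i => ⟨(hE i).aemeasurable, (hE 0).aemeasurable, by rw [(hE i).map_eq, (hE 0).map_eq]⟩)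
  rw [hmean] at hlln
  filter_upwards [hlln] with ω hω
  -- `arrival E m` has `m + 1` summands, so the law of large numbers is read at `m + 1` and divided
  -- by `m / (m + 1) → 1`.
  have h1 := hω.comp (tendsto_add_atTop_nat 1)
  have h2 : Tendsto (fun n : ℕ => (n : ℝ) / ((n : ℝ) + 1)) atTop (𝓝 1) :=
    tendsto_natCast_div_add_atTop (1 : ℝ)
  have h3 := h1.div h2 one_ne_zero
  rw [div_one] at h3
  refine h3.congr' ?_
  filter_upwards [eventually_gt_atTop 0] with m hm
  have : (m : ℝ) ≠ 0 := by positivity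
  have h3 : (m : ℝ) + 1 ≠ 0 := by positivity
  simp only [Function.comp, Pi.div_apply, arrival]
  push_cast
  field_simp

end ArrivalAsymptotics

/-! ### Change of probability space and Slutsky's theorem. -/

section ConvergenceInDistribution

variable {F : Type*} [NormedAddCommGroup F] [MeasurableSpace F] [BorelSpace F]
  {Ω'' : Type*} [MeasurableSpace Ω''] {ν : Measure Ω''} [IsProbabilityMeasure ν] {Z : Ω'' → F}

lemma tendstoInDistribution_of_map_eq {Ω₁ Ω₂ : ℕ → Type*} [∀ n, MeasurableSpace (Ω₁ n)]
    [∀ n, MeasurableSpace (Ω₂ n)] {μ₁ : (n : ℕ) → Measure (Ω₁ n)} {μ₂ : (n : ℕ) → Measure (Ω₂ n)}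
    [∀ n, IsProbabilityMeasure (μ₁ n)] [∀ n, IsProbabilityMeasure (μ₂ n)]
    {X : (n : ℕ) → Ω₁ n → F} {Y : (n : ℕ) → Ω₂ n → F}
    (h : TendstoInDistribution X atTop Z μ₁ ν) (hY : ∀ n, AEMeasurable (Y n) (μ₂ n))
    (heq : ∀ n, (μ₂ n).map (Y n) = (μ₁ n).map (X n)) :
    TendstoInDistribution Y atTop Z μ₂ ν where
  forall_aemeasurable := hY
  aemeasurable_limit := h.aemeasurable_limit
  tendsto := h.tendsto.congr fun n => Subtype.ext (heq n).symm

/-- **Slutsky's theorem** for random variables living on varying probability spaces. -/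
lemma tendstoInDistribution_of_tendsto_measure_sub [SecondCountableTopology F] {Ω : ℕ → Type*}
    [∀ n, MeasurableSpace (Ω n)] {μ : (n : ℕ) → Measure (Ω n)} [∀ n, IsProbabilityMeasure (μ n)]
    {X Y : (n : ℕ) → Ω n → F} (h : TendstoInDistribution X atTop Z μ ν)
    (hY : ∀ n, AEMeasurable (Y n) (μ n))
    (hsub : ∀ ε : ℝ, 0 < ε → Tendsto (fun n => μ n {ω | ε ≤ ‖Y n ω - X n ω‖}) atTop (𝓝 0)) :
    TendstoInDistribution Y atTop Z μ ν := by
  -- All variables are moved to the product of the probability spaces, where convergence in measure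
  -- makes sense; the coordinate maps preserve the individual laws.
  have hmp : ∀ n, MeasurePreserving (Function.eval n) (Measure.infinitePi μ) (μ n) :=
    fun n => measurePreserving_eval_infinitePi μ n
  have hXm := h.forall_aemeasurable
  have hmap : ∀ (W : (n : ℕ) → Ω n → F), (∀ n, AEMeasurable (W n) (μ n)) → ∀ n,
      (Measure.infinitePi μ).map (fun ω => W n (ω n)) = (μ n).map (W n) := by
    intro W hW n
    have hW' : AEMeasurable (W n) ((Measure.infinitePi μ).map (Function.eval n)) := by
      rw [(hmp n).map_eq]; exact hW n
    have h2 := AEMeasurable.map_map_of_aemeasurable hW' (hmp n).measurable.aemeasurable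
    rw [(hmp n).map_eq] at h2
    exact h2.symm
  have hcomp : ∀ (W : (n : ℕ) → Ω n → F), (∀ n, AEMeasurable (W n) (μ n)) → ∀ n,
      AEMeasurable (fun ω => W n (ω n)) (Measure.infinitePi μ) := fun W hW n =>
    (hW n).comp_quasiMeasurePreserving (hmp n).quasiMeasurePreserving
  have h1 : TendstoInDistribution (fun n (ω : (n : ℕ) → Ω n) => X n (ω n)) atTop Z
      (fun _ => Measure.infinitePi μ) ν :=
    tendstoInDistribution_of_map_eq h (hcomp X hXm) (hmap X hXm)
  have h2 := tendstoInDistribution_of_tendstoInMeasure_sub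
    (fun n (ω : (n : ℕ) → Ω n) => Y n (ω n)) Z h1 (by
      rw [tendstoInMeasure_iff_norm]
      intro ε hε
      refine (hsub ε hε).congr fun n => ?_
      have hnull : NullMeasurableSet {ω | ε ≤ ‖Y n ω - X n ω‖} (μ n) :=
        nullMeasurableSet_le aemeasurable_const ((hY n).sub (hXm n)).norm
      rw [← (hmp n).measure_preimage hnull]
      simp [Set.preimage, Function.eval])
    (hcomp Y hY)
  exact tendstoInDistribution_of_map_eq h2 hY fun n => (hmap Y hY n).symm

end ConvergenceInDistribution

/-! ### Extremes of iid arrays. -/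

section IidOrderStatistics

variable {Ω'' : Type*} [MeasurableSpace Ω''] {Q : Measure Ω''} {E : ℕ → Ω'' → ℝ}

/-- The first `k` order statistics of a vector. -/
noncomputable def topOrderStats {ι : Type*} [Fintype ι] (k : ℕ) (d : ι → ℝ) (j : Fin k) : ℝ :=
  orderStat d j

lemma measurable_topOrderStats {ι : Type*} [Fintype ι] (k : ℕ) :
    Measurable (topOrderStats (ι := ι) k) :=
  measurable_pi_iff.2 fun j => measurable_orderStat j

lemma aemeasurable_normalized_arrivals (hE : ∀ k, HasLaw (E k) (expMeasure 1) Q) (p : ℕ) :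
    AEMeasurable (fun ω (i : Fin p) => (arrival E p ω)⁻¹ * arrival E i ω) Q :=
  aemeasurable_pi_iff.2 fun i =>
    (aemeasurable_arrival hE p).inv.mul (aemeasurable_arrival hE i)

lemma measurable_tailQuantile_comp {ν : Measure ℝ} [IsProbabilityMeasure ν] (p : ℕ) :
    Measurable fun (u : Fin p → ℝ) i => tailQuantile ν (u i) :=
  measurable_pi_iff.2 fun i => measurable_tailQuantile.comp (measurable_pi_apply i)

lemma aemeasurable_limitPoint (hE : ∀ k, HasLaw (E k) (expMeasure 1) Q) (α b : ℝ) (i : ℕ) :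
    AEMeasurable (limitPoint α b E i) Q :=
  ((aemeasurable_arrival hE i).pow_const _).const_mul _

variable [IsProbabilityMeasure Q]

/-- An iid sample has the law of the quantile transform of independent uniforms. Order statistics
are symmetric functions, so the uniforms may be replaced by normalized arrivals. -/
lemma map_topOrderStats_eq (hE : ∀ k, HasLaw (E k) (expMeasure 1) Q) (hind : iIndepFun E Q)
    {Ω' : Type*} [MeasurableSpace Ω'] {P : Measure Ω'} {p : ℕ} {Y : Ω' → Fin p → ℝ}
    {ν : Measure ℝ} [IsProbabilityMeasure ν] (hν : ν (Set.Iio 0) = 0)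
    (hY : HasLaw Y (Measure.pi fun _ => ν) P) (k : ℕ) :
    P.map (fun ω => topOrderStats k (Y ω)) = Q.map (fun ω => topOrderStats k
      fun i : Fin p => tailQuantile ν ((arrival E p ω)⁻¹ * arrival E i ω)) := by
  have hΦ : Measurable (topOrderStats (ι := Fin p) k) := measurable_topOrderStats k
  have hT := measurable_tailQuantile_comp (ν := ν) p
  have hprob : IsProbabilityMeasure ((volume : Measure ℝ).restrict (Set.Icc 0 1)) :=
    ⟨by simp⟩
  have hm : IsProbabilityMeasure
      (((volume : Measure ℝ).restrict (Set.Icc 0 1)).map (tailQuantile ν)) := by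
    rw [map_tailQuantile hν]; infer_instance
  have hpi := Measure.pi_map_pi (μ := fun _ : Fin p => (volume : Measure ℝ).restrict (Set.Icc 0 1))
    (f := fun _ => tailQuantile ν) (fun _ => measurable_tailQuantile.aemeasurable)
  simp only [map_tailQuantile hν] at hpi
  have hZ := aemeasurable_normalized_arrivals hE p
  have hleft : P.map (fun ω => topOrderStats k (Y ω))
      = (Measure.pi fun _ : Fin p => (volume : Measure ℝ).restrict (Set.Icc 0 1)).map
        (fun u => topOrderStats k fun i => tailQuantile ν (u i)) := by
    have h1 := Measure.map_map (μ := Measure.pi fun _ : Fin p =>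
      (volume : Measure ℝ).restrict (Set.Icc 0 1)) hΦ hT
    rw [hpi, ← hY.map_eq, AEMeasurable.map_map_of_aemeasurable hΦ.aemeasurable
      hY.aemeasurable] at h1
    exact h1
  rw [hleft]
  have hΨ : Measurable fun u : Fin p → ℝ => topOrderStats k fun i => tailQuantile ν (u i) :=
    hΦ.comp hT
  refine Measure.ext fun s hs => ?_
  refine Eq.trans ?_ (congrArg (fun ρ : Measure (Fin k → ℝ) => ρ s)
    (AEMeasurable.map_map_of_aemeasurable hΨ.aemeasurable hZ))
  rw [Measure.map_apply hΨ hs, Measure.map_apply hΨ hs]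
  have hsymm : ∀ (σ : Equiv.Perm (Fin p)) (u : Fin p → ℝ),
      (topOrderStats k fun i => tailQuantile ν (u (σ i)))
        = topOrderStats k fun i => tailQuantile ν (u i) := fun σ u => by
    ext j
    exact orderStat_comp_equiv (fun i => tailQuantile ν (u i)) σ j
  set S := (fun u : Fin p → ℝ => topOrderStats k fun i => tailQuantile ν (u i)) ⁻¹' s with hSdef
  have hS : MeasurableSet S := hΨ hs
  have hI : Measurable (S.indicator (1 : (Fin p → ℝ) → ENNReal)) := measurable_one.indicator hS
  have h2 := lintegral_uniform_eq_arrivals hE hind hI fun σ u => by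
    classical
    simp only [Set.indicator_apply, hSdef, Set.mem_preimage, hsymm, Pi.one_apply]
  rw [lintegral_indicator_one hS] at h2
  rw [h2, ← lintegral_map' hI.aemeasurable hZ, lintegral_indicator_one hS]

/-- The largest order statistics of an iid array with intensity `b x^{-α/2}` converge to the points
of the Poisson process with that intensity. -/
theorem tendstoInDistribution_topOrderStats_iid (hE : ∀ k, HasLaw (E k) (expMeasure 1) Q)
    (hind : iIndepFun E Q) {Ω' : ℕ → Type*} [∀ n, MeasurableSpace (Ω' n)]
    {P : (n : ℕ) → Measure (Ω' n)} [∀ n, IsProbabilityMeasure (P n)] {p : ℕ → ℕ}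
    (hp : Tendsto p atTop atTop) {Y : (n : ℕ) → Ω' n → Fin (p n) → ℝ} {ν : ℕ → Measure ℝ}
    (hνp : ∀ n, IsProbabilityMeasure (ν n)) (hν : ∀ n, ν n (Set.Iio 0) = 0)
    (hY : ∀ n, HasLaw (Y n) (Measure.pi fun _ => ν n) (P n)) {α b : ℝ} (hα : 0 < α) (hb : 0 ≤ b)
    (htail : ∀ x : ℝ, 0 < x →
      Tendsto (fun n => (p n : ℝ) * (ν n).real (Set.Ioi x)) atTop (𝓝 (b * x ^ (-(α / 2)))))
    (k : ℕ) :
    TendstoInDistribution (fun n ω => topOrderStats k (Y n ω)) atTop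
      (fun ω (j : Fin k) => limitPoint α b E j ω) P Q := by
  have hm : ∀ n, AEMeasurable (fun ω => topOrderStats k
      fun i : Fin (p n) => tailQuantile (ν n) ((arrival E (p n) ω)⁻¹ * arrival E i ω)) Q := fun n =>
    ((measurable_topOrderStats k).comp
      (measurable_tailQuantile_comp (p n))).comp_aemeasurable
      (aemeasurable_normalized_arrivals hE (p n))
  -- In this coupling every `n` uses the same exponentials, so almost sure convergence can be
  -- proved.
  have hconv : TendstoInDistribution (fun n ω => topOrderStats k
      fun i : Fin (p n) => tailQuantile (ν n) ((arrival E (p n) ω)⁻¹ * arrival E i ω)) atTop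
      (fun ω (j : Fin k) => limitPoint α b E j ω) (fun _ => Q) Q := by
    refine tendstoInDistribution_of_ae_tendsto hm
      (aemeasurable_pi_iff.2 fun j => aemeasurable_limitPoint hE α b j) ?_
    filter_upwards [ae_forall_exponential_pos hE, ae_tendsto_arrival_div hE hind] with ω hpos hlln
    rw [tendsto_pi_nhds]
    intro j
    have hΓ := fun i => arrival_pos hpos i
    have hu : ∀ᶠ n in atTop, 0 < (arrival E (p n) ω)⁻¹ * arrival E j ω :=
      Eventually.of_forall fun n => mul_pos (inv_pos.2 (hΓ _)) (hΓ _)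
    have huv : Tendsto (fun n => (p n : ℝ) * ((arrival E (p n) ω)⁻¹ * arrival E j ω)) atTop
        (𝓝 (arrival E j ω)) := by
      have h1 := ((hlln.comp hp).inv₀ one_ne_zero).mul_const (arrival E j ω)
      rw [inv_one, one_mul] at h1
      refine h1.congr fun n => ?_
      simp only [Function.comp, inv_div]
      ring
    refine (tendsto_tailQuantile hνp hα hb htail hu (hΓ j) huv).congr' ?_
    filter_upwards [hp.eventually_gt_atTop (j : ℕ)] with n hn
    -- Arrivals increase and the tail quantile decreases, so the `j`-th largest value sits at the
    -- `j`-th arrival once `j < p n`.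
    have h2 := orderStat_comp_of_antitoneOn (antitoneOn_tailQuantile (ν := ν n))
      (tailQuantile_nonneg (ν n))
      (γ := fun i : Fin (p n) => (arrival E (p n) ω)⁻¹ * arrival E i ω)
      (fun i l hil => mul_le_mul_of_nonneg_left ((strictMono_arrival hpos).monotone hil)
        (inv_pos.2 (hΓ _)).le)
      (fun i => mul_pos (inv_pos.2 (hΓ _)) (hΓ _)) ⟨j, hn⟩
    exact h2.symm
  exact tendstoInDistribution_of_map_eq hconv
    (fun n => (measurable_topOrderStats k).comp_aemeasurable (hY n).aemeasurable)
    (fun n => map_topOrderStats_eq hE hind (hν n) (hY n) k)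

end IidOrderStatistics

/-! ### Point measures: measurability, local finiteness, integrals. -/

section PointMeasures

lemma pointMeasure_apply {ι : Type*} (x : ι → ℝ) {s : Set ℝ} (hs : MeasurableSet s) :
    pointMeasure x s = ∑' i, (s ∩ Set.Ioi 0).indicator 1 (x i) := by
  have hs' := hs.inter (measurableSet_Ioi (a := (0 : ℝ)))
  rw [pointMeasure, Measure.restrict_apply hs, Measure.sum_apply _ hs']
  exact tsum_congr fun i => Measure.dirac_apply' _ hs'

lemma measurable_pointMeasure {ι : Type*} [Countable ι] :
    Measurable (pointMeasure : (ι → ℝ) → Measure ℝ) := by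
  refine Measure.measurable_of_measurable_coe _ fun s hs => ?_
  simp_rw [pointMeasure_apply _ hs]
  refine Measurable.tsum fun i => ?_
  exact (measurable_one.indicator (hs.inter measurableSet_Ioi)).comp (measurable_pi_apply i)

lemma exists_pos_le_of_isCompact {K : Set ℝ} (hK : IsCompact K) (h0 : K ⊆ Set.Ioi 0) :
    ∃ c : ℝ, 0 < c ∧ ∀ x ∈ K, c ≤ x := by
  rcases K.eq_empty_or_nonempty with rfl | hne
  · exact ⟨1, one_pos, by simp⟩
  · obtain ⟨c, hc⟩ := hK.exists_isLeast hne
    exact ⟨c, h0 hc.1, fun x hx => hc.2 hx⟩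

lemma pointMeasure_lt_top {ι : Type*} {x : ι → ℝ} {K : Set ℝ} (hK : IsCompact K) {c : ℝ}
    (hc : ∀ y ∈ K, c ≤ y) (F : Finset ι) (hF : ∀ i ∉ F, x i < c) : pointMeasure x K < ⊤ := by
  rw [pointMeasure_apply _ hK.measurableSet, tsum_eq_sum (s := F)]
  · refine ENNReal.sum_lt_top.2 fun i _ => ?_
    refine lt_of_le_of_lt (Set.indicator_le_self _ _ _) ?_
    exact ENNReal.one_lt_top
  · intro i hi
    refine Set.indicator_of_notMem (fun hmem => ?_) _
    exact absurd (hc _ hmem.1) (not_le.2 (hF i hi))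

lemma integral_pointMeasure {ι : Type*} {x : ι → ℝ} {f : ℝ → ℝ} (hf : Continuous f)
    (hf0 : ∀ y, 0 ≤ f y) (hsupp : tsupport f ⊆ Set.Ioi 0) {c : ℝ} (hc : ∀ y, y < c → f y = 0)
    (F : Finset ι) (hF : ∀ i ∉ F, x i < c) :
    ∫ y, f y ∂(pointMeasure x) = ∑ i ∈ F, f (x i) := by
  rw [pointMeasure, setIntegral_eq_integral_of_forall_compl_eq_zero fun y hy => by
      by_contra hne
      exact hy (hsupp (subset_tsupport f hne)),
    integral_eq_lintegral_of_nonneg_ae (Eventually.of_forall hf0) hf.aestronglyMeasurable,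
    lintegral_sum_measure]
  simp only [lintegral_dirac' _ hf.measurable.ennreal_ofReal]
  rw [tsum_eq_sum (s := F) fun i hi => by rw [hc _ (hF i hi), ENNReal.ofReal_zero],
    ENNReal.toReal_sum fun i _ => ENNReal.ofReal_ne_top]
  exact Finset.sum_congr rfl fun i _ => ENNReal.toReal_ofReal (hf0 _)

lemma measurable_integral_of_nonneg {f : ℝ → ℝ} (hf : Continuous f) (hf0 : ∀ y, 0 ≤ f y) :
    Measurable fun ξ : Measure ℝ => ∫ y, f y ∂ξ := by
  have : (fun ξ : Measure ℝ => ∫ y, f y ∂ξ)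
      = fun ξ : Measure ℝ => (∫⁻ y, ENNReal.ofReal (f y) ∂ξ).toReal := by
    ext ξ
    exact integral_eq_lintegral_of_nonneg_ae (Eventually.of_forall hf0) hf.aestronglyMeasurable
  rw [this]
  exact (Measure.measurable_lintegral hf.measurable.ennreal_ofReal).ennreal_toReal

end PointMeasures

/-! ### From the largest points to Laplace functionals. -/

section LaplaceFunctionals

/-- A continuous function between the indicators of `[c, ∞)` and of `[c / 2, ∞)`. -/
noncomputable def softIndicator (c x : ℝ) : ℝ := max 0 (min 1 (2 * x / c - 1))

lemma continuous_softIndicator (c : ℝ) : Continuous (softIndicator c) := by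
  unfold softIndicator
  fun_prop

lemma softIndicator_nonneg (c x : ℝ) : 0 ≤ softIndicator c x := le_max_left _ _

lemma softIndicator_le_one (c x : ℝ) : softIndicator c x ≤ 1 :=
  max_le zero_le_one (min_le_left _ _)

lemma softIndicator_eq_one {c x : ℝ} (hc : 0 < c) (h : c ≤ x) : softIndicator c x = 1 := by
  have : 1 ≤ 2 * x / c - 1 := by
    rw [le_sub_iff_add_le, le_div_iff₀ hc]
    linarith
  rw [softIndicator, min_eq_left this]
  exact max_eq_right zero_le_one

lemma softIndicator_zero (c : ℝ) : softIndicator c 0 = 0 := by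
  simp [softIndicator]

/-- If `s m < c`, all points from index `m` on lie below `c` and truncation changes nothing.
Otherwise the soft indicator is `1`, which bounds the distance of two numbers in `[0, 1]`. -/
lemma abs_exp_neg_sub_le {s : ℕ → ℝ} (hs : Antitone s) {f : ℝ → ℝ} (hf0 : ∀ y, 0 ≤ f y) {c I : ℝ}
    (hc : 0 < c) (hI0 : 0 ≤ I)
    (hI : ∀ N, (∀ j, N ≤ j → s j < c) → I = ∑ j ∈ Finset.range N, f (s j)) (m : ℕ) :
    |Real.exp (-I) - Real.exp (-∑ j ∈ Finset.range m, f (s j))| ≤ softIndicator c (s m) := by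
  rcases lt_or_ge (s m) c with h | h
  · rw [hI m fun j hj => (hs hj).trans_lt h, sub_self, abs_zero]
    exact softIndicator_nonneg _ _
  · rw [softIndicator_eq_one hc h]
    have h1 : Real.exp (-I) ≤ 1 := Real.exp_le_one_iff.2 (by linarith)
    have h2 : Real.exp (-∑ j ∈ Finset.range m, f (s j)) ≤ 1 :=
      Real.exp_le_one_iff.2 (by linarith [Finset.sum_nonneg fun j (_ : j ∈ Finset.range m) => hf0 (s j)])
    rw [abs_le]
    constructor <;> linarith [Real.exp_pos (-I), Real.exp_pos (-∑ j ∈ Finset.range m, f (s j))]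

lemma tendsto_integral_of_tendstoInDistribution {F : Type*} [TopologicalSpace F]
    [MeasurableSpace F] [BorelSpace F] {Ω : ℕ → Type*} [∀ n, MeasurableSpace (Ω n)]
    {μ : (n : ℕ) → Measure (Ω n)} [∀ n, IsProbabilityMeasure (μ n)] {Ω' : Type*}
    [MeasurableSpace Ω'] {ν : Measure Ω'} [IsProbabilityMeasure ν] {X : (n : ℕ) → Ω n → F}
    {Z : Ω' → F} (h : TendstoInDistribution X atTop Z μ ν) {g : F → ℝ} (hg : Continuous g) {C : ℝ}
    (hC : ∀ x, |g x| ≤ C) :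
    Tendsto (fun n => ∫ ω, g (X n ω) ∂(μ n)) atTop (𝓝 (∫ ω, g (Z ω) ∂ν)) := by
  have h1 := ProbabilityMeasure.tendsto_iff_forall_integral_tendsto.1 h.tendsto
    (BoundedContinuousFunction.ofNormedAddCommGroup g hg C hC)
  simp only [ProbabilityMeasure.coe_mk, BoundedContinuousFunction.coe_ofNormedAddCommGroup] at h1
  rw [integral_map h.aemeasurable_limit hg.measurable.aestronglyMeasurable] at h1
  refine h1.congr fun n => ?_
  rw [integral_map (h.forall_aemeasurable n) hg.measurable.aestronglyMeasurable]

lemma abs_integral_sub_le {Ω : Type*} [MeasurableSpace Ω] {μ : Measure Ω} [IsProbabilityMeasure μ]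
    {u v w : Ω → ℝ} (hu : AEMeasurable u μ) (hv : AEMeasurable v μ) (hw : AEMeasurable w μ)
    (hu1 : ∀ ω, |u ω| ≤ 1) (hv1 : ∀ ω, |v ω| ≤ 1) (hw1 : ∀ ω, |w ω| ≤ 1)
    (h : ∀ᵐ ω ∂μ, |u ω - v ω| ≤ w ω) : |∫ ω, u ω ∂μ - ∫ ω, v ω ∂μ| ≤ ∫ ω, w ω ∂μ := by
  have hint : ∀ {z : Ω → ℝ}, AEMeasurable z μ → (∀ ω, |z ω| ≤ 1) → Integrable z μ :=
    fun hz hz1 => Integrable.of_bound hz.aestronglyMeasurable 1 (Eventually.of_forall hz1)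
  rw [← integral_sub (hint hu hu1) (hint hv hv1)]
  refine (abs_integral_le_integral_abs).trans ?_
  exact integral_mono_ae ((hint hu hu1).sub (hint hv hv1)).abs (hint hw hw1) h

/-- Convergence of the Laplace functionals follows from the convergence in distribution of the
largest points. -/
theorem tendsto_laplace_of_tendstoInDistribution {Ω : ℕ → Type*} [∀ n, MeasurableSpace (Ω n)]
    {μ : (n : ℕ) → Measure (Ω n)} [∀ n, IsProbabilityMeasure (μ n)] {Ω' : Type*}
    [MeasurableSpace Ω'] {ν : Measure Ω'} [IsProbabilityMeasure ν] {s : (n : ℕ) → Ω n → ℕ → ℝ}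
    {z : Ω' → ℕ → ℝ}
    (h : ∀ k : ℕ, TendstoInDistribution (fun n ω (j : Fin k) => s n ω j) atTop
      (fun ω (j : Fin k) => z ω j) μ ν)
    {I : (n : ℕ) → Ω n → ℝ} {J : Ω' → ℝ} (hIm : ∀ n, AEMeasurable (I n) (μ n))
    (hJm : AEMeasurable J ν) (hI0 : ∀ n ω, 0 ≤ I n ω) (hJ0 : ∀ ω, 0 ≤ J ω) {f : ℝ → ℝ}
    (hf : Continuous f) (hf0 : ∀ y, 0 ≤ f y) {c : ℝ}
    (hI : ∀ n, ∀ᵐ ω ∂(μ n), ∀ m,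
      |Real.exp (-I n ω) - Real.exp (-∑ j ∈ Finset.range m, f (s n ω j))|
        ≤ softIndicator c (s n ω m))
    (hJ : ∀ᵐ ω ∂ν, ∀ m, |Real.exp (-J ω) - Real.exp (-∑ j ∈ Finset.range m, f (z ω j))|
        ≤ softIndicator c (z ω m))
    (hz : ∀ᵐ ω ∂ν, Tendsto (z ω) atTop (𝓝 0)) :
    Tendsto (fun n => ∫ ω, Real.exp (-I n ω) ∂(μ n)) atTop (𝓝 (∫ ω, Real.exp (-J ω) ∂ν)) := by
  have hexp : ∀ {x : ℝ}, 0 ≤ x → |Real.exp (-x)| ≤ 1 := fun hx => by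
    rw [abs_of_pos (Real.exp_pos _)]
    exact Real.exp_le_one_iff.2 (by linarith)
  have hsoft : ∀ x, |softIndicator c x| ≤ 1 := fun x => by
    rw [abs_of_nonneg (softIndicator_nonneg _ _)]
    exact softIndicator_le_one _ _
  have hsum0 : ∀ (v : ℕ → ℝ) m, 0 ≤ ∑ j ∈ Finset.range m, f (v j) := fun v m =>
    Finset.sum_nonneg fun j _ => hf0 _
  have hsm : ∀ n j, AEMeasurable (fun ω => s n ω j) (μ n) := fun n j =>
    (measurable_pi_apply (Fin.last j)).comp_aemeasurable ((h (j + 1)).forall_aemeasurable n)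
  have hzm : ∀ j, AEMeasurable (fun ω => z ω j) ν := fun j =>
    (measurable_pi_apply (Fin.last j)).comp_aemeasurable (h (j + 1)).aemeasurable_limit
  have hsoftm := (continuous_softIndicator c).measurable
  have hvm : ∀ n m, AEMeasurable
      (fun ω => Real.exp (-∑ j ∈ Finset.range m, f (s n ω j))) (μ n) := fun n m =>
    Real.measurable_exp.comp_aemeasurable (Finset.aemeasurable_fun_sum _ fun j _ =>
      hf.measurable.comp_aemeasurable (hsm n j)).neg
  have hvm' : ∀ m, AEMeasurable
      (fun ω => Real.exp (-∑ j ∈ Finset.range m, f (z ω j))) ν := fun m =>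
    Real.measurable_exp.comp_aemeasurable (Finset.aemeasurable_fun_sum _ fun j _ =>
      hf.measurable.comp_aemeasurable (hzm j)).neg
  have hsn : ∀ m n, |∫ ω, Real.exp (-I n ω) ∂(μ n)
      - ∫ ω, Real.exp (-∑ j ∈ Finset.range m, f (s n ω j)) ∂(μ n)|
      ≤ ∫ ω, softIndicator c (s n ω m) ∂(μ n) := fun m n =>
    abs_integral_sub_le (Real.measurable_exp.comp_aemeasurable (hIm n).neg) (hvm n m)
      (hsoftm.comp_aemeasurable (hsm n m)) (fun ω => hexp (hI0 n ω)) (fun ω => hexp (hsum0 _ _))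
      (fun ω => hsoft _) ((hI n).mono fun ω hω => hω m)
  have hsz : ∀ m, |∫ ω, Real.exp (-J ω) ∂ν
      - ∫ ω, Real.exp (-∑ j ∈ Finset.range m, f (z ω j)) ∂ν|
      ≤ ∫ ω, softIndicator c (z ω m) ∂ν := fun m =>
    abs_integral_sub_le (Real.measurable_exp.comp_aemeasurable hJm.neg) (hvm' m)
      (hsoftm.comp_aemeasurable (hzm m)) (fun ω => hexp (hJ0 ω)) (fun ω => hexp (hsum0 _ _))
      (fun ω => hsoft _) (hJ.mono fun ω hω => hω m)
  have htail : Tendsto (fun m => ∫ ω, softIndicator c (z ω m) ∂ν) atTop (𝓝 0) := by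
    have h1 := tendsto_integral_of_dominated_convergence (μ := ν)
      (F := fun m ω => softIndicator c (z ω m)) (f := fun _ => 0) (fun _ => 1)
      (fun m => (hsoftm.comp_aemeasurable (hzm m)).aestronglyMeasurable) (integrable_const 1)
      (fun m => Eventually.of_forall fun ω => hsoft _)
      (hz.mono fun ω hω => by
        have := ((continuous_softIndicator c).tendsto 0).comp hω
        rwa [softIndicator_zero] at this)
    simpa using h1
  rw [Metric.tendsto_atTop']
  intro ε hε
  -- `m` is chosen from the limit alone; continuity of the soft indicator carries its bound over to
  -- large `n`. The two truncation errors and the difference of truncated functionals each cost at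
  -- most `ε / 4`.
  obtain ⟨m, hm⟩ := (htail.eventually_lt_const (by positivity : 0 < ε / 4)).exists
  have hA := tendsto_integral_of_tendstoInDistribution (h (m + 1))
    (g := fun v => softIndicator c (v (Fin.last m)))
    ((continuous_softIndicator c).comp (continuous_apply _)) (fun v => hsoft _)
  have hB := tendsto_integral_of_tendstoInDistribution (h m)
    (g := fun v => Real.exp (-∑ j, f (v j))) (by fun_prop)
    (fun v => hexp (Finset.sum_nonneg fun j _ => hf0 _))
  simp only [Fin.val_last] at hA
  have hFs : ∀ n ω, ∑ j : Fin m, f (s n ω j) = ∑ j ∈ Finset.range m, f (s n ω j) :=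
    fun n ω => Fin.sum_univ_eq_sum_range (fun j => f (s n ω j)) m
  have hFz : ∀ ω, ∑ j : Fin m, f (z ω j) = ∑ j ∈ Finset.range m, f (z ω j) :=
    fun ω => Fin.sum_univ_eq_sum_range (fun j => f (z ω j)) m
  simp only [hFs, hFz] at hB
  have hA' := hA.eventually_lt_const hm
  have hB' := Metric.tendsto_nhds.1 hB (ε / 4) (by positivity)
  obtain ⟨N, hN⟩ := (hA'.and hB').exists_forall_of_atTop
  refine ⟨N, fun n hn => ?_⟩
  obtain ⟨h1, h2⟩ := hN n hn.le
  rw [Real.dist_eq] at h2 ⊢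
  have h3 := hsn m n
  have h4 := hsz m
  rw [abs_lt] at h2 ⊢
  rw [abs_le] at h3 h4
  constructor <;> linarith [h2.1, h2.2, h3.1, h3.2, h4.1, h4.2]

end LaplaceFunctionals

/-! ### Laws of rows and of their sums of squares. -/

section RowLaws

variable {Ω : Type*} [MeasurableSpace Ω] {μ : Measure Ω} {X : ℕ → Ω → ℝ}

lemma IsStrictlyStationary.identDistrib (h : IsStrictlyStationary X μ) (t : ℕ) :
    IdentDistrib (X t) (X 0) μ μ := by
  have h1 := (h t).comp (measurable_pi_apply (X := fun _ : ℕ => ℝ) 0)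
  simpa [Function.comp_def] using h1

lemma sum_fin_succ_eq_sum_Icc (n : ℕ) (g : ℕ → ℝ) :
    ∑ t : Fin n, g (t + 1) = ∑ t ∈ Finset.Icc 1 n, g t := by
  rw [Fin.sum_univ_eq_sum_range (fun t => g (t + 1)), Finset.range_eq_Ico,
    Finset.sum_Ico_add' g 0 n 1]
  rfl

/-- The law of the normalized sum of squares of a row of length `n`. -/
noncomputable def scaledSquareLaw (X : ℕ → Ω → ℝ) (μ : Measure Ω) (n : ℕ) (c : ℝ) : Measure ℝ :=
  μ.map fun ω => c * ∑ t : Fin n, X (t + 1) ω ^ 2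

lemma aemeasurable_scaledSquare (hX : ∀ t, AEMeasurable (X t) μ) (n : ℕ) (c : ℝ) :
    AEMeasurable (fun ω => c * ∑ t : Fin n, X (t + 1) ω ^ 2) μ :=
  (Finset.aemeasurable_fun_sum _ fun _ _ => (hX _).pow_const 2).const_mul c

lemma scaledSquareLaw_Iio (hX : ∀ t, AEMeasurable (X t) μ) (n : ℕ) {c : ℝ} (hc : 0 ≤ c) :
    scaledSquareLaw X μ n c (Set.Iio 0) = 0 := by
  rw [scaledSquareLaw, Measure.map_apply_of_aemeasurable (aemeasurable_scaledSquare hX n c)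
    measurableSet_Iio]
  refine measure_mono_null (fun ω hω => ?_) measure_empty
  have h1 : c * ∑ t : Fin n, X (t + 1) ω ^ 2 < 0 := hω
  have h2 : 0 ≤ c * ∑ t : Fin n, X (t + 1) ω ^ 2 :=
    mul_nonneg hc (Finset.sum_nonneg fun t _ => sq_nonneg _)
  exact absurd h1 (not_lt.2 h2)

lemma scaledSquareLaw_real_Ioi (hX : ∀ t, AEMeasurable (X t) μ) (n : ℕ) {A : ℝ} (hA : 0 < A)
    (x : ℝ) : (scaledSquareLaw X μ n A⁻¹).real (Set.Ioi x)
      = μ.real {ω | A * x < ∑ t ∈ Finset.Icc 1 n, X t ω ^ 2} := by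
  rw [scaledSquareLaw, map_measureReal_apply_of_aemeasurable (aemeasurable_scaledSquare hX n _)
    measurableSet_Ioi]
  congr 1
  ext ω
  simp only [Set.mem_preimage, Set.mem_Ioi, Set.mem_ofPred_eq]
  rw [lt_inv_mul_iff₀ hA, sum_fin_succ_eq_sum_Icc n fun t => X t ω ^ 2]

variable {Ω' : Type*} [MeasurableSpace Ω'] {P : Measure Ω'} {p n : ℕ}
  {M : Ω' → Matrix (Fin p) (Fin n) ℝ}

/-- The diagonal entries are one fixed function of independent, identically distributed rows, hence
iid whatever the dependence inside a row. -/
lemma hasLaw_scaledSquares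
    (hcopy : ∀ i : Fin p,
      IdentDistrib (fun ω (t : Fin n) => M ω i t) (fun ω (t : Fin n) => X (t + 1) ω) P μ)
    (hindep : iIndepFun (fun (i : Fin p) ω (t : Fin n) => M ω i t) P) (c : ℝ) :
    HasLaw (fun ω i => c * ∑ t, M ω i t ^ 2)
      (Measure.pi fun _ => scaledSquareLaw X μ n c) P := by
  have hg : Measurable fun v : Fin n → ℝ => c * ∑ t, v t ^ 2 := by fun_prop
  have h1 : ∀ i, HasLaw (fun ω => c * ∑ t, M ω i t ^ 2) (scaledSquareLaw X μ n c) P := fun i =>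
    ⟨hg.comp_aemeasurable (hcopy i).aemeasurable_fst, ((hcopy i).comp hg).map_eq⟩
  exact iIndepFun.hasLaw_pi h1 (hindep.comp (fun _ => fun v => c * ∑ t, v t ^ 2) fun _ => hg)

lemma lintegral_entry_rpow_eq (hstat : IsStrictlyStationary X μ)
    (hcopy : ∀ i : Fin p,
      IdentDistrib (fun ω (t : Fin n) => M ω i t) (fun ω (t : Fin n) => X (t + 1) ω) P μ)
    (r : ℝ) (i : Fin p) (t : Fin n) :
    ∫⁻ ω, ENNReal.ofReal (|M ω i t| ^ r) ∂P = ∫⁻ ω, ENNReal.ofReal (|X 0 ω| ^ r) ∂μ := by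
  have h1 : IdentDistrib (fun ω => M ω i t) (X 0) P μ :=
    ((hcopy i).comp (measurable_pi_apply t)).trans (hstat.identDistrib (t + 1))
  have hg : Measurable fun x : ℝ => ENNReal.ofReal (|x| ^ r) := by fun_prop
  exact (h1.comp hg).lintegral_eq

end RowLaws

/-! ### Measurability and point measures of the eigenvalues. -/

section Eigenvalues

variable {Ω' : Type*} [MeasurableSpace Ω'] {P : Measure Ω'} {p n : ℕ}
  {M : Ω' → Matrix (Fin p) (Fin n) ℝ}

lemma aemeasurable_gramEigenvaluesSorted
    (hM : ∀ i, AEMeasurable (fun ω (t : Fin n) => M ω i t) P) (j : ℕ) :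
    AEMeasurable (fun ω => gramEigenvaluesSorted (M ω) j) P :=
  (continuous_gramEigenvaluesSorted j).measurable.comp_aemeasurable (aemeasurable_pi_iff.2 hM)

lemma aemeasurable_pointMeasure_gramEigenvalues
    (hM : ∀ i, AEMeasurable (fun ω (t : Fin n) => M ω i t) P) (c : ℝ) :
    AEMeasurable (fun ω => pointMeasure fun i => c * gramEigenvalues (M ω) i) P := by
  obtain ⟨e, he⟩ := gramEigenvalues_eq_sorted p n
  simp only [he]
  exact measurable_pointMeasure.comp_aemeasurable (aemeasurable_pi_iff.2 fun i =>
    (aemeasurable_gramEigenvaluesSorted hM _).const_mul c)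

lemma antitone_mul_gramEigenvaluesSorted (A : Matrix (Fin p) (Fin n) ℝ) {c : ℝ} (hc : 0 ≤ c) :
    Antitone fun j => c * gramEigenvaluesSorted A j := by
  intro i j hij
  refine mul_le_mul_of_nonneg_left ?_ hc
  by_cases hj : j < p
  · exact gramEigenvaluesSorted_antitone A
      (show (⟨i, hij.trans_lt hj⟩ : Fin p) ≤ ⟨j, hj⟩ from hij)
  · have : gramEigenvaluesSorted A j = 0 := by simp [gramEigenvaluesSorted, hj]
    exact this.le.trans (gramEigenvaluesSorted_nonneg A i)

lemma integral_pointMeasure_gramEigenvalues {f : ℝ → ℝ} (hf : Continuous f)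
    (hf0 : ∀ y, 0 ≤ f y) (hsupp : tsupport f ⊆ Set.Ioi 0) {c₀ : ℝ} (hc₀ : 0 < c₀)
    (hzero : ∀ y, y < c₀ → f y = 0) (A : Matrix (Fin p) (Fin n) ℝ) (c : ℝ) {N : ℕ}
    (hN : ∀ j, N ≤ j → c * gramEigenvaluesSorted A j < c₀) :
    ∫ y, f y ∂(pointMeasure fun i => c * gramEigenvalues A i)
      = ∑ j ∈ Finset.range N, f (c * gramEigenvaluesSorted A j) := by
  obtain ⟨e, he⟩ := gramEigenvalues_eq_sorted p n
  rw [integral_pointMeasure hf hf0 hsupp hzero Finset.univ fun i hi => absurd (Finset.mem_univ i) hi]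
  simp only [he]
  rw [e.sum_comp fun j : Fin p => f (c * gramEigenvaluesSorted A j),
    Fin.sum_univ_eq_sum_range fun j => f (c * gramEigenvaluesSorted A j)]
  -- `N` and `p` come in either order. The surplus terms vanish in both cases: past `p` the sorted
  -- eigenvalue is the default `0`, and past `N` the point lies below the support of `f`.
  have hp0 : ∀ j, p ≤ j → f (c * gramEigenvaluesSorted A j) = 0 := fun j hj => by
    have : gramEigenvaluesSorted A j = 0 := by simp [gramEigenvaluesSorted, hj]
    rw [this, mul_zero, hzero 0 hc₀]
  have hN0 : ∀ j, N ≤ j → f (c * gramEigenvaluesSorted A j) = 0 := fun j hj => hzero _ (hN j hj)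
  rcases le_total p N with h | h
  · refine Finset.sum_subset (Finset.range_mono h) fun j _ hj => hp0 j ?_
    simpa using hj
  · refine (Finset.sum_subset (Finset.range_mono h) fun j _ hj => hN0 j ?_).symm
    simpa using hj

end Eigenvalues

/-! ### The limiting points decrease to zero. -/

section LimitProcess

variable {Ω : Type*} {E : ℕ → Ω → ℝ} {α b : ℝ}

lemma antitone_limitPoint {ω : Ω} (h : ∀ k, 0 < E k ω) (hα : 0 < α) (hb : 0 ≤ b) :
    Antitone fun i => limitPoint α b E i ω := fun i j hij =>
  mul_le_mul_of_nonneg_left (Real.rpow_le_rpow_of_nonpos (arrival_pos h i)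
    ((strictMono_arrival h).monotone hij) (neg_nonpos.2 (by positivity))) (by positivity)

variable [MeasurableSpace Ω] {Q : Measure Ω} [IsProbabilityMeasure Q]

lemma ae_tendsto_limitPoint (hE : ∀ k, HasLaw (E k) (expMeasure 1) Q) (hind : iIndepFun E Q)
    (hα : 0 < α) (b : ℝ) :
    ∀ᵐ ω ∂Q, Tendsto (fun i => limitPoint α b E i ω) atTop (𝓝 0) := by
  filter_upwards [ae_tendsto_arrival_div hE hind] with ω hω
  have h1 : Tendsto (fun m : ℕ => arrival E m ω) atTop atTop := by
    refine (hω.pos_mul_atTop one_pos tendsto_natCast_atTop_atTop).congr' ?_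
    filter_upwards [eventually_gt_atTop 0] with m hm
    have : (m : ℝ) ≠ 0 := by positivity
    field_simp
  have h2 := ((tendsto_rpow_neg_atTop (y := 2 / α) (by positivity)).comp h1).const_mul
    (b ^ (2 / α))
  rw [mul_zero] at h2
  exact h2

end LimitProcess

/-! ### Assembly of the main theorem. -/

section MainTheorem

variable {Ω : Type*} [MeasurableSpace Ω] {μ : Measure Ω} [IsProbabilityMeasure μ] {X : ℕ → Ω → ℝ}
  {α β b : ℝ} {a : ℕ → ℝ} {p : ℕ → ℕ} {Ω' : ℕ → Type*} [∀ n, MeasurableSpace (Ω' n)]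
  {P : (n : ℕ) → Measure (Ω' n)}
  {M : (n : ℕ) → Ω' n → Matrix (Fin (p n)) (Fin n) ℝ}

lemma eventually_normalizing_pos (hα0 : 0 < α) (hreg : IsRegVaryingWith (X 0) μ α a)
    (hp : Tendsto p atTop atTop) : ∀ᶠ n in atTop, 0 < a (n * p n) :=
  (tendsto_id.atTop_mul_atTop₀ hp).eventually (eventually_pos_of_regVarying
    (antitone_tail (μ := μ) fun ω => |X 0 ω|) hα0 hreg)

/-- The off-diagonal part of the Gram matrix is asymptotically negligible. -/
theorem tendsto_measure_offDiagBound (hstat : IsStrictlyStationary X μ) (hα0 : 0 < α)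
    (hreg : IsRegVaryingWith (X 0) μ α a) (hp : Tendsto p atTop atTop) (hβ0 : 0 < β)
    (hβ : 1 < α → β < (2 - α) / (α - 1))
    (hpβ : (fun n => (p n : ℝ)) =O[atTop] (fun n : ℕ => (n : ℝ) ^ β))
    (hcopy : ∀ (n : ℕ) (i : Fin (p n)),
      IdentDistrib (fun ω (t : Fin n) => M n ω i t) (fun ω (t : Fin n) => X (t + 1) ω) (P n) μ)
    (hindep : ∀ n : ℕ, iIndepFun (fun (i : Fin (p n)) ω (t : Fin n) => M n ω i t) (P n))
    {η : ℝ} (hη : 0 < η) :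
    Tendsto (fun n => P n {ω | ∃ i, a (n * p n) ^ 2 * η < offDiagBound (M n ω) i}) atTop
      (𝓝 0) := by
  -- `r < α` makes the moments finite, while `s > α` gives the polynomial lower bound for the
  -- normalizing sequence.
  obtain ⟨r, s, hr0, hrα, hαs, hθ⟩ := exists_moment_exponents hα0 hβ0 hβ
  obtain ⟨c, hc, ha⟩ := exists_mul_le_rpow_normalizing
    (antitone_tail (μ := μ) fun ω => |X 0 ω|) (fun _ => measureReal_nonneg) hα0 hreg hαs
  have hmom := lintegral_rpow_lt_top_of_regVarying (hstat.identDistrib 0).aemeasurable_fst hα0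
    hreg hr0 hrα
  set κ := (∫⁻ ω, ENNReal.ofReal (|X 0 ω| ^ r) ∂μ).toReal with hκ
  have hlim := ENNReal.tendsto_ofReal (tendsto_dimension_mul_rpow (κ := κ) hp hβ0 hpβ hr0
    (hα0.trans hαs) hθ hc hη ha)
  rw [ENNReal.ofReal_zero] at hlim
  refine tendsto_of_tendsto_of_tendsto_of_le_of_le' tendsto_const_nhds hlim
    (Eventually.of_forall fun _ => zero_le) ?_
  filter_upwards [eventually_normalizing_pos hα0 hreg hp, hp.eventually_gt_atTop 0,
    eventually_gt_atTop 0] with n han hpn hn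
  exact measure_exists_offDiagBound_gt_le (fun i => (hcopy n i).aemeasurable_fst) (hindep n) hr0
    ENNReal.toReal_nonneg
    (fun i t => by rw [lintegral_entry_rpow_eq hstat (hcopy n) r i t,
      ENNReal.ofReal_toReal hmom.ne])
    (by positivity) (Nat.mul_pos hn hpn)

variable [∀ n, IsProbabilityMeasure (P n)]

/-- Slutsky's theorem: the scaled diagonal entries form an iid array whose tail intensity is `hld`,
and the eigenvalues differ from them by a quantity vanishing in probability. -/
theorem tendstoInDistribution_eigenvalues (hstat : IsStrictlyStationary X μ) (hα0 : 0 < α)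
    (hreg : IsRegVaryingWith (X 0) μ α a) (hp : Tendsto p atTop atTop) (hβ0 : 0 < β)
    (hβ : 1 < α → β < (2 - α) / (α - 1))
    (hpβ : (fun n => (p n : ℝ)) =O[atTop] (fun n : ℕ => (n : ℝ) ^ β)) (hb : 0 ≤ b)
    (hld : ∀ x : ℝ, 0 < x →
      Tendsto (fun n : ℕ =>
          (p n : ℝ) * μ.real {ω | a (n * p n) ^ 2 * x < ∑ t ∈ Finset.Icc 1 n, X t ω ^ 2})
        atTop (𝓝 (b * x ^ (-(α / 2)))))
    (hcopy : ∀ (n : ℕ) (i : Fin (p n)),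
      IdentDistrib (fun ω (t : Fin n) => M n ω i t) (fun ω (t : Fin n) => X (t + 1) ω) (P n) μ)
    (hindep : ∀ n : ℕ, iIndepFun (fun (i : Fin (p n)) ω (t : Fin n) => M n ω i t) (P n))
    {Ω'' : Type*} [MeasurableSpace Ω''] {Q : Measure Ω''} [IsProbabilityMeasure Q]
    {E : ℕ → Ω'' → ℝ} (hE : ∀ k, HasLaw (E k) (expMeasure 1) Q) (hEindep : iIndepFun E Q) (k : ℕ) :
    TendstoInDistribution
      (fun n ω (j : Fin k) => (a (n * p n) ^ 2)⁻¹ * gramEigenvaluesSorted (M n ω) j)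
      atTop (fun ω (j : Fin k) => limitPoint α b E j ω) P Q := by
  have hX : ∀ t, AEMeasurable (X t) μ := fun t => (hstat.identDistrib t).aemeasurable_fst
  have hapos := eventually_normalizing_pos hα0 hreg hp
  have hdiag := tendstoInDistribution_topOrderStats_iid hE hEindep hp
    (ν := fun n => scaledSquareLaw X μ n (a (n * p n) ^ 2)⁻¹)
    (fun n => Measure.isProbabilityMeasure_map (aemeasurable_scaledSquare hX n _))
    (fun n => scaledSquareLaw_Iio hX n (by positivity))
    (fun n => hasLaw_scaledSquares (hcopy n) (hindep n) _) hα0 hb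
    (fun x hx => (hld x hx).congr' (by
      filter_upwards [hapos] with n hn
      rw [scaledSquareLaw_real_Ioi hX n (by positivity) x])) k
  refine tendstoInDistribution_of_tendsto_measure_sub hdiag (fun n => aemeasurable_pi_iff.2
    fun j => (aemeasurable_gramEigenvaluesSorted
      (fun i => (hcopy n i).aemeasurable_fst) j).const_mul _) fun ε hε => ?_
  -- With `ε / 2`, outside the off-diagonal event the difference is at most `ε / 2`, which excludes
  -- the non-strict event `ε ≤ ‖·‖`.
  have hoff := tendsto_measure_offDiagBound hstat hα0 hreg hp hβ0 hβ hpβ hcopy hindep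
    (half_pos hε)
  refine tendsto_of_tendsto_of_tendsto_of_le_of_le' tendsto_const_nhds hoff
    (Eventually.of_forall fun _ => zero_le) ?_
  filter_upwards [hapos] with n hn
  refine measure_mono fun ω hω => ?_
  simp only [Set.mem_ofPred_eq] at hω ⊢
  by_contra! hall
  have hA : 0 < a (n * p n) ^ 2 := by positivity
  have hle : ‖(fun j : Fin k => (a (n * p n) ^ 2)⁻¹ * gramEigenvaluesSorted (M n ω) j)
      - topOrderStats k fun i => (a (n * p n) ^ 2)⁻¹ * ∑ t, M n ω i t ^ 2‖ ≤ ε / 2 := by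
    rw [pi_norm_le_iff_of_nonneg (half_pos hε).le]
    intro j
    rw [Pi.sub_apply, topOrderStats, orderStat_const_mul _ (inv_pos.2 hA), ← mul_sub, norm_mul,
      Real.norm_eq_abs, Real.norm_eq_abs, abs_of_pos (inv_pos.2 hA), inv_mul_le_iff₀ hA]
    exact abs_gramEigenvaluesSorted_sub_le (M n ω) (by positivity) hall j
  linarith

theorem tendstoPointProcess_of_tendstoInDistribution (hα0 : 0 < α) (hb : 0 ≤ b)
    {c : ℕ → ℝ} (hc : ∀ n, 0 ≤ c n)
    (hM : ∀ n i, AEMeasurable (fun ω (t : Fin n) => M n ω i t) (P n))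
    {Ω'' : Type*} [MeasurableSpace Ω''] {Q : Measure Ω''} [IsProbabilityMeasure Q]
    {E : ℕ → Ω'' → ℝ} (hE : ∀ k, HasLaw (E k) (expMeasure 1) Q) (hEindep : iIndepFun E Q)
    (h : ∀ k : ℕ, TendstoInDistribution
      (fun n ω (j : Fin k) => c n * gramEigenvaluesSorted (M n ω) j)
      atTop (fun ω (j : Fin k) => limitPoint α b E j ω) P Q) :
    TendstoPointProcess (fun n ω => pointMeasure fun i => c n * gramEigenvalues (M n ω) i)
      (fun ω => pointMeasure fun i => limitPoint α b E i ω) P Q where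
  process n :=
    { aemeasurable := aemeasurable_pointMeasure_gramEigenvalues (hM n) (c n)
      locally_finite := Eventually.of_forall fun ω K hK hK0 => by
        obtain ⟨c₀, -, hle⟩ := exists_pos_le_of_isCompact hK hK0
        exact pointMeasure_lt_top hK hle Finset.univ fun i hi => absurd (Finset.mem_univ i) hi }
  process_limit :=
    { aemeasurable := measurable_pointMeasure.comp_aemeasurable
        (aemeasurable_pi_iff.2 fun i => aemeasurable_limitPoint hE α b i)
      locally_finite := by
        filter_upwards [ae_tendsto_limitPoint hE hEindep hα0 b] with ω hω K hK hK0
        obtain ⟨c₀, hc₀, hle⟩ := exists_pos_le_of_isCompact hK hK0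
        obtain ⟨N, hN⟩ := (hω.eventually_lt_const hc₀).exists_forall_of_atTop
        exact pointMeasure_lt_top hK hle (Finset.range N) fun i hi => hN i (by simpa using hi) }
  laplace f hf hf0 hcomp hsupp := by
    obtain ⟨c₀, hc₀, hle⟩ := exists_pos_le_of_isCompact hcomp hsupp
    have hzero : ∀ y, y < c₀ → f y = 0 := fun y hy => by
      by_contra hne
      exact absurd (hle y (subset_tsupport f hne)) (not_le.2 hy)
    have hmeas := measurable_integral_of_nonneg hf hf0
    refine tendsto_laplace_of_tendstoInDistribution
      (s := fun n ω j => c n * gramEigenvaluesSorted (M n ω) j)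
      (z := fun ω j => limitPoint α b E j ω) h
      (fun n => hmeas.comp_aemeasurable (aemeasurable_pointMeasure_gramEigenvalues (hM n) (c n)))
      (hmeas.comp_aemeasurable (measurable_pointMeasure.comp_aemeasurable
        (aemeasurable_pi_iff.2 fun i => aemeasurable_limitPoint hE α b i)))
      (fun n ω => integral_nonneg hf0) (fun ω => integral_nonneg hf0) hf hf0 (c := c₀) ?_ ?_
      (ae_tendsto_limitPoint hE hEindep hα0 b)
    · intro n
      refine Eventually.of_forall fun ω m => ?_
      exact abs_exp_neg_sub_le (antitone_mul_gramEigenvaluesSorted (M n ω) (hc n)) hf0 hc₀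
        (integral_nonneg hf0)
        (fun N hN => integral_pointMeasure_gramEigenvalues hf hf0 hsupp hc₀ hzero _ _ hN) m
    · filter_upwards [ae_forall_exponential_pos hE] with ω hpos m
      exact abs_exp_neg_sub_le (antitone_limitPoint hpos hα0 hb) hf0 hc₀ (integral_nonneg hf0)
        (fun N hN => integral_pointMeasure hf hf0 hsupp hzero (Finset.range N)
          fun i hi => hN i (by simpa using hi)) m

end MainTheorem

end HeavyTail

theorem theorem1
    -- the strictly stationary sequence `X`, with regularly varying and tail balanced marginals
    {Ω : Type*} [MeasurableSpace Ω] (μ : Measure Ω) [IsProbabilityMeasure μ]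
    (X : ℕ → Ω → ℝ) (hstat : HeavyTail.IsStrictlyStationary X μ)
    (α : ℝ) (hα0 : 0 < α) (hα2 : α < 2)
    (a : ℕ → ℝ) (hreg : HeavyTail.IsRegVaryingWith (X 0) μ α a)
    (hbal : HeavyTail.IsTailBalanced (X 0) μ)
    -- the dimension `p = p_n`
    (p : ℕ → ℕ) (hp : Tendsto p atTop atTop)
    (β : ℝ) (hβ0 : 0 < β) (hβ : 1 < α → β < (2 - α) / (α - 1))
    (hpβ : (fun n => (p n : ℝ)) =O[atTop] (fun n : ℕ => (n : ℝ) ^ β))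
    -- the large deviation condition
    (b : ℝ) (hb : 0 ≤ b)
    (hld : ∀ x : ℝ, 0 < x →
      Tendsto (fun n : ℕ =>
          (p n : ℝ) * μ.real {ω | a (n * p n) ^ 2 * x < ∑ t ∈ Finset.Icc 1 n, X t ω ^ 2})
        atTop (𝓝 (b * x ^ (-(α / 2)))))
    -- for each `n`, a random `p × n` matrix whose rows are independent copies of `X_1, …, X_n`
    {Ω' : ℕ → Type*} [∀ n, MeasurableSpace (Ω' n)]
    (P : (n : ℕ) → Measure (Ω' n)) [∀ n, IsProbabilityMeasure (P n)]
    (M : (n : ℕ) → Ω' n → Matrix (Fin (p n)) (Fin n) ℝ)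
    (hcopy : ∀ (n : ℕ) (i : Fin (p n)),
      IdentDistrib (fun ω (t : Fin n) => M n ω i t) (fun ω (t : Fin n) => X (t + 1) ω) (P n) μ)
    (hindep : ∀ n : ℕ, iIndepFun (fun (i : Fin (p n)) ω (t : Fin n) => M n ω i t) (P n))
    -- iid standard exponential random variables
    {Ω'' : Type*} [MeasurableSpace Ω''] (Q : Measure Ω'') [IsProbabilityMeasure Q]
    (E : ℕ → Ω'' → ℝ) (hE : ∀ k, HasLaw (E k) (expMeasure 1) Q) (hEindep : iIndepFun E Q) :
    HeavyTail.TendstoPointProcess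
      (fun n ω => HeavyTail.pointMeasure
        (fun i => (a (n * p n) ^ 2)⁻¹ * HeavyTail.gramEigenvalues (M n ω) i))
      (fun ω => HeavyTail.pointMeasure (fun i => HeavyTail.limitPoint α b E i ω)) P Q ∧
    ∀ k : ℕ, TendstoInDistribution
      (fun n ω (j : Fin k) =>
        (a (n * p n) ^ 2)⁻¹ * HeavyTail.gramEigenvaluesSorted (M n ω) j)
      atTop (fun ω (j : Fin k) => HeavyTail.limitPoint α b E j ω) P Q := by
  have h := HeavyTail.tendstoInDistribution_eigenvalues hstat hα0 hreg hp hβ0 hβ hpβ hb hld hcopy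
    hindep hE hEindep
  exact ⟨HeavyTail.tendstoPointProcess_of_tendstoInDistribution hα0 hb (fun n => by positivity)
    (fun n i => (hcopy n i).aemeasurable_fst) hE hEindep h, h⟩
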